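/- A *clone* on a set $A$ is a family of finitary operations on $A$ (of arity at least $1$) that contains all projections and is closed under composition; clones are ordered by inclusion, and $\vee$ denotes the join in the complete lattice of all clones on $\mathbb{Z}_8$. Let $P(\mathbb{Z}_8,+)$ be the clone of all operations $a_0+a_1x_1+\dots+a_nx_n$ ($n\ge 1$, $a_0\in\mathbb{Z}_8$, $a_1,\dots,a_n\in\mathbb{Z}$). For a tuple $\mathbf{x}=(x_A)$ over $\mathbb{Z}_8$, indexed by the subsets $A$ of $\{1,2,3,4\}$, put $a_A=(-1)^{|A|}\sum_{B\subseteq A}(-1)^{|B|}x_B$, and let $Z$ be the set of all such tuples with - $a_{\{2\}}\equiv 2a_{\{1\}}$ and $a_{\{4\}}\equiv 2a_{\{3\}} \pmod 4$; - $a_A\equiv 0\pmod 2$ whenever $|A|\ge 2$; - $a_A\equiv 0\pmod 4$ whenever $|A|\ge 2$ and $A\cap\{2,4\}\neq\emptyset$; - $a_A=0$ whenever $\{2,4\}\subseteq A$. Let $M_1$ be the clone of all polynomial operations of the ring $\mathbb{Z}_8$ that preserve the relation $Z$. For an operation $f$ on $\mathbb{Z}_8$ let $C(f)$ be the clone generated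 by $f$, the addition and the unary constant operations. Put $r_n=x_1\cdots x_n$, $p_n=x_1^2x_2\cdots x_n$, $q_n=x_1^3x_2\cdots x_n$, $u_n=x_1\cdots x_n(x_1+1)$ for $n\ge 1$ and $v_n=x_1\cdots x_n(x_1+x_2)$ for $n\ge 2$. For $n\ge 1$ let $t_n$ be $x_1\cdots x_n(x_1+\dots+x_n)$ if $n$ is even and $x_1\cdots x_n(x_1+\dots+x_n+1)$ if $n$ is odd, and let $s_n$ be $x_1\cdots x_n(x_1+\dots+x_n)$ if $n$ is odd and $x_1\cdots x_n(x_1+\dots+x_n+1)$ if $n$ is even. **Theorem.** $M_1$ consists exactly of the operations of arity at least $1$ that can be expressed by a polynomial over $\mathbb{Z}_8$ in which every monomial of degree at least $2$ has an even coefficient. Moreover, for every clone $K$ with $P(\mathbb{Z}_8,+)\subseteq K\subseteq M_1$ there are $n_1,\dots,n_8\in\{0,1,2,\dots\}\cup\{\infty\}$ such that $$K=C(2t_{n_1})\vee C(2u_{n_2})\vee C(2v_{n_3})\vee C(2s_{n_4})\vee C(2p_{n_5})\vee C(2q_{n_6})\vee C(2r_{n_7})\vee C(4r_{n_8}).$$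 Here $n_i=0$ (and also $n_3=1$) means that the corresponding joinand is absent, the join with no joinands being $P(\mathbb{Z}_8,+)$; and $n_i=\infty$ means that the joinand is the join of the clones $C(\cdot)$ of all operations of the corresponding type. -/

import Mathlib

namespace CloneZ8

/-- `n`-ary operations on `A`. -/
abbrev Op (A : Type*) (n : ℕ) : Type _ := (Fin n → A) → A

/-- A clone on `A`: a family of finitary operations (of arity at least `1`) that contains all
projections and is closed under composition. The set `ops n` consists of its `n`-ary members. -/
@[ext]
structure Clone (A : Type*) where
  ops : ∀ n : ℕ, Set (Op A n)
  arity_pos : ∀ {n : ℕ} {f : Op A n}, f ∈ ops n → 0 < n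
  proj_mem : ∀ (n : ℕ) (i : Fin n), (fun x => x i) ∈ ops n
  comp_mem : ∀ {n m : ℕ} {f : Op A n} {g : Fin n → Op A m}, f ∈ ops n → (∀ i, g i ∈ ops m) →
    (fun x => f fun i => g i x) ∈ ops m

namespace Clone

variable {A : Type*}

/-- Clones are ordered by inclusion. -/
instance : PartialOrder (Clone A) where
  le C D := ∀ n, C.ops n ⊆ D.ops n
  le_refl _ _ := subset_rfl
  le_trans _ _ _ h₁ h₂ n := (h₁ n).trans (h₂ n)
  le_antisymm _ _ h₁ h₂ := Clone.ext (funext fun n => (h₁ n).antisymm (h₂ n))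

/-- The intersection of a set of clones. -/
instance : InfSet (Clone A) where
  sInf S :=
    { ops := fun n => {f | 0 < n ∧ ∀ C ∈ S, f ∈ C.ops n}
      arity_pos := fun h => h.1
      proj_mem := fun n i => ⟨i.pos, fun C _ => C.proj_mem n i⟩
      comp_mem := fun hf hg =>
        ⟨(hg ⟨0, hf.1⟩).1, fun C hC => C.comp_mem (hf.2 C hC) fun i => (hg i).2 C hC⟩ }

theorem isGLB_sInf' (S : Set (Clone A)) : IsGLB S (sInf S) :=
  ⟨fun C hC _ _ hf => hf.2 C hC,
    fun D hD n _ hf => ⟨D.arity_pos hf, fun _ hC => hD hC n hf⟩⟩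

/-- The complete lattice of all clones on `A`, ordered by inclusion; joins are least upper
bounds. -/
instance : CompleteLattice (Clone A) := completeLatticeOfInf _ isGLB_sInf'

/-- The clone generated by a set of operations: the least clone containing it. -/
def generate (F : Set (Σ n : ℕ, Op A n)) : Clone A :=
  sInf {C | ∀ s ∈ F, s.2 ∈ C.ops s.1}

end Clone

/-- An operation `f` on `A` preserves the relation `R ⊆ A ^ ι`. -/
def Preserves {A ι : Type*} {n : ℕ} (f : Op A n) (R : Set (ι → A)) : Prop :=
  ∀ u : Fin n → ι → A, (∀ i, u i ∈ R) → (fun j => f fun i => u i j) ∈ R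

/-- `P(ℤ₈, +)`: the operations `a₀ + a₁ x₁ + ⋯ + aₙ xₙ` with `a₀ ∈ ℤ₈` and integers `aᵢ`. -/
def groupPolynomials : Clone (ZMod 8) where
  ops n := {f | 0 < n ∧ ∃ (a₀ : ZMod 8) (a : Fin n → ℤ), ∀ x, f x = a₀ + ∑ i, a i • x i}
  arity_pos h := h.1
  proj_mem n i := ⟨i.pos, 0, Pi.single i 1, fun x => by simp [Pi.single_apply]⟩
  comp_mem := by
    rintro n m f g ⟨hn, a₀, a, hf⟩ hg
    choose hm b₀ b hb using hg
    refine ⟨hm ⟨0, hn⟩, a₀ + ∑ i, a i • b₀ i, fun j => ∑ i, a i * b i j, fun x => ?_⟩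
    simp only [hf, hb, smul_add, Finset.sum_add_distrib, Finset.smul_sum, Finset.sum_smul,
      mul_smul, add_assoc]
    congr 2
    exact Finset.sum_comm

/-- `P(ℤ₈, +, ·)`: the operations given by polynomials over the ring `ℤ₈`. -/
noncomputable def ringPolynomials : Clone (ZMod 8) where
  ops n := {f | 0 < n ∧ ∃ p : MvPolynomial (Fin n) (ZMod 8), ∀ x, f x = MvPolynomial.eval x p}
  arity_pos h := h.1
  proj_mem n i := ⟨i.pos, MvPolynomial.X i, fun x => by simp⟩
  comp_mem := by
    rintro n m f g ⟨hn, p, hf⟩ hg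
    choose hm q hq using hg
    refine ⟨hm ⟨0, hn⟩, MvPolynomial.bind₁ q p, fun x => ?_⟩
    refine (hf _).trans ?_
    refine Eq.trans ?_ (MvPolynomial.eval₂Hom_bind₁ _ x q p).symm
    exact congrArg (fun y => MvPolynomial.eval y p) (funext fun i => hq i x)

/-- The coordinates `a_A = (-1)^|A| ∑_{B ⊆ A} (-1)^|B| x_B` of a tuple `x = (x_B)` indexed by the
subsets of a four-element set, with respect to the basis `g^A`, where `g^A_B = 1` if `A ⊆ B` and
`g^A_B = 0` otherwise. -/
def moebius (x : Finset (Fin 4) → ZMod 8) (A : Finset (Fin 4)) : ZMod 8 :=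
  (-1) ^ A.card * ∑ B ∈ A.powerset, (-1) ^ B.card * x B

/-- The relation `Z` on `ℤ₈` of arity `2 ^ 4`. The index set `{1, 2, 3, 4}` is represented by
`Fin 4 = {0, 1, 2, 3}`, the element `k` by `k - 1`; `4 ∣ a - b` in `ℤ₈` is `a ≡ b (mod 4)`. -/
def Z : Set (Finset (Fin 4) → ZMod 8) :=
  {x | (4 ∣ moebius x {1} - 2 * moebius x {0} ∧ 4 ∣ moebius x {3} - 2 * moebius x {2}) ∧
    (∀ A, 2 ≤ A.card → 2 ∣ moebius x A) ∧
    (∀ A, 2 ≤ A.card → (1 ∈ A ∨ 3 ∈ A) → 4 ∣ moebius x A) ∧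
    (∀ A, 1 ∈ A → 3 ∈ A → moebius x A = 0)}

/-- `M₁`: the clone of all ring polynomial operations on `ℤ₈` that preserve `Z`. -/
noncomputable def M₁ : Clone (ZMod 8) where
  ops n := {f | f ∈ ringPolynomials.ops n ∧ Preserves f Z}
  arity_pos h := ringPolynomials.arity_pos h.1
  proj_mem n i := ⟨ringPolynomials.proj_mem n i, fun _ hu => hu i⟩
  comp_mem hf hg := ⟨ringPolynomials.comp_mem hf.1 fun i => (hg i).1,
    fun u hu => hf.2 _ fun i => (hg i).2 u hu⟩

/-- `C(f)`: the clone generated by `f`, the addition and the unary constant operations. -/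
def C {n : ℕ} (f : Op (ZMod 8) n) : Clone (ZMod 8) :=
  Clone.generate ({⟨n, f⟩, ⟨2, fun x => x 0 + x 1⟩} ∪ Set.range fun c => ⟨1, fun _ => c⟩)

/-- The `k`-th variable (counted from `0`); the value `0` for `k ≥ n` is never used below. -/
def var {n : ℕ} (k : ℕ) (x : Fin n → ZMod 8) : ZMod 8 := if h : k < n then x ⟨k, h⟩ else 0

/-- `rₙ = x₁ ⋯ xₙ`. -/
def r (n : ℕ) : Op (ZMod 8) n := fun x => ∏ i, x i

/-- `tₙ = x₁ ⋯ xₙ (x₁ + ⋯ + xₙ)` for even `n` and `x₁ ⋯ xₙ (x₁ + ⋯ + xₙ + 1)` for odd `n`. -/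
def t (n : ℕ) : Op (ZMod 8) n :=
  fun x => (∏ i, x i) * (if Even n then ∑ i, x i else (∑ i, x i) + 1)

/-- `sₙ = x₁ ⋯ xₙ (x₁ + ⋯ + xₙ)` for odd `n` and `x₁ ⋯ xₙ (x₁ + ⋯ + xₙ + 1)` for even `n`. -/
def s (n : ℕ) : Op (ZMod 8) n :=
  fun x => (∏ i, x i) * (if Odd n then ∑ i, x i else (∑ i, x i) + 1)

/-- `pₙ = x₁² x₂ ⋯ xₙ`, for `n ≥ 1`. -/
def p (n : ℕ) : Op (ZMod 8) n := fun x => (∏ i, x i) * var 0 x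

/-- `qₙ = x₁³ x₂ ⋯ xₙ`, for `n ≥ 1`. -/
def q (n : ℕ) : Op (ZMod 8) n := fun x => (∏ i, x i) * var 0 x ^ 2

/-- `uₙ = x₁ ⋯ xₙ (x₁ + 1)`, for `n ≥ 1`. -/
def u (n : ℕ) : Op (ZMod 8) n := fun x => (∏ i, x i) * (var 0 x + 1)

/-- `vₙ = x₁ ⋯ xₙ (x₁ + x₂)`, for `n ≥ 2`. -/
def v (n : ℕ) : Op (ZMod 8) n := fun x => (∏ i, x i) * (var 0 x + var 1 x)

/-- The joinand of index `N` given by a sequence `f` of operations `fₙ`, `n ≥ k`. It is `C(f_N)`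
for finite `N ≥ k`, and the join of all `C(fₙ)`, `n ≥ k`, for `N = ∞`. For `N < k` the joinand is
absent, that is, equal to the bottom element `P(ℤ₈, +)` of the interval. -/
def joinand (f : ∀ n, Op (ZMod 8) n) (k : ℕ) : ℕ∞ → Clone (ZMod 8)
  | ⊤ => ⨆ n ≥ k, C (f n)
  | (N : ℕ) => if k ≤ N then C (f N) else groupPolynomials

end CloneZ8

namespace CloneZ8

/-! ### The relation `Z` -/

section Moebius

variable {x y : Finset (Fin 4) → ZMod 8} {i j : Fin 4} {A : Finset (Fin 4)}

/-! The description of `M₁` rests on two facts. First, `Z` is a submodule containing the constant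
tuples, and it lies in a subring `subringZ` whose double lies in `Z`. Hence monomials of degree at
most 1 preserve `Z` with any coefficient, and all other monomials preserve it with an even one.
Second, if `f` preserves `Z`, then applying `f` to tuples built from `direction` gives, for `i ≠ j`,
`2 ∣ Δᵢ Δⱼ f`, `4 ∣ Δᵢ² f` and `Δᵢ² Δⱼ² f = 0`. In a falling factorial expansion of `f`, differences
act as formal derivatives, so these conditions restrict `k! · coeff k`. For degree at least 2 they
leave only an even coefficient or `k! = 0`; in the latter case the term is the zero function,
because `k!` divides the product of falling factorials (`hasEvenNonlinear_of_preserves`).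

For the second claim, a clone above `P(ℤ₈, +)` is treated as an additive group of functions of
countably many variables, closed under substitution (`Closed`). Twice a monomial with variable set
`A` depends only on the two lowest binary digits and is a pure function `pureFn A c α β`, where only
`c` mod 4 and `α`, `β` mod 2 matter. Every member of `M₁` is affine plus a sum of pure functions
with distinct `A`, and setting variables to 0 isolates each summand. A clone in the interval is thus
determined by its pure functions.

Substitutions such as `-x`, `x + 1`, `x + y` and permutations of variables show which pure functions
produce which others. If `β` is not even, all pure functions on `A` with even `c` appear, and the
generator is of type `q` or `v`. If `β = 0` and `α` is not constant mod 2, then `v` is present and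
only the parities of `c` and of the sum of `α` matter, giving `u`, `r`, `p`. If `β = 0` and `α` is
constant, the types are `t`, `r`, `s` and `4r`. So an inclusion of clones follows from an inclusion
of generators (`Closed.transfer`, `le_of_transfer`). Each type is closed under lowering the arity,
so a single number in `ℕ∞` records which of its members occur (`exists_joinand`). -/

theorem moebius_add (x y : Finset (Fin 4) → ZMod 8) (A : Finset (Fin 4)) :
    moebius (x + y) A = moebius x A + moebius y A := by
  simp only [moebius, Pi.add_apply, mul_add, Finset.sum_add_distrib]

theorem moebius_smul (c : ZMod 8) (x : Finset (Fin 4) → ZMod 8) (A : Finset (Fin 4)) :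
    moebius (c • x) A = c * moebius x A := by
  simp only [moebius, Pi.smul_apply, smul_eq_mul, Finset.mul_sum]
  exact Finset.sum_congr rfl fun B _ => by ring

theorem moebius_const (c : ZMod 8) (hA : A.Nonempty) : moebius (fun _ => c) A = 0 := by
  have h := congrArg (Int.cast : ℤ → ZMod 8) (Finset.sum_powerset_neg_one_pow_card_of_nonempty hA)
  push_cast at h
  rw [moebius, ← Finset.sum_mul, h, zero_mul, mul_zero]

theorem dvd_moebius {d : ZMod 8} (h : ∀ B, d ∣ x B) (A : Finset (Fin 4)) : d ∣ moebius x A :=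
  Dvd.dvd.mul_left (Finset.dvd_sum fun B _ => (h B).mul_left _) _

/-- The difference of a tuple in direction `i`. -/
def diff (i : Fin 4) (x : Finset (Fin 4) → ZMod 8) : Finset (Fin 4) → ZMod 8 :=
  fun B => x (insert i B) - x B

/-- Pairing each `B` with `insert i B` makes every coordinate an iterated difference, which is how
the conditions defining `Z` are handled below. -/
theorem moebius_insert (x : Finset (Fin 4) → ZMod 8) (hi : i ∉ A) :
    moebius x (insert i A) = moebius (diff i x) A := by
  unfold moebius diff
  rw [Finset.sum_powerset_insert hi, Finset.card_insert_of_notMem hi]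
  have h : ∑ B ∈ A.powerset, (-1 : ZMod 8) ^ (insert i B).card * x (insert i B) =
      -∑ B ∈ A.powerset, (-1) ^ B.card * x (insert i B) := by
    rw [← Finset.sum_neg_distrib]
    refine Finset.sum_congr rfl fun B hB => ?_
    rw [Finset.card_insert_of_notMem fun h => hi (Finset.mem_powerset.1 hB h)]
    ring
  simp only [h, mul_sub, Finset.sum_sub_distrib]
  ring

theorem moebius_empty (x : Finset (Fin 4) → ZMod 8) : moebius x ∅ = x ∅ := by
  simp [moebius]

theorem moebius_singleton (x : Finset (Fin 4) → ZMod 8) (i : Fin 4) :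
    moebius x {i} = x {i} - x ∅ := by
  rw [← insert_empty_eq, moebius_insert x (Finset.notMem_empty i), moebius_empty]
  rfl

theorem moebius_pair (x : Finset (Fin 4) → ZMod 8) (hij : i ≠ j) :
    moebius x {i, j} = x {i, j} - x {j} - (x {i} - x ∅) := by
  rw [moebius_insert x (by simpa using hij), moebius_singleton]
  simp [diff]

theorem eq_sum_moebius (B : Finset (Fin 4)) : ∀ x, x B = ∑ A ∈ B.powerset, moebius x A := by
  induction B using Finset.induction_on with
  | empty => intro x; simp [moebius_empty]
  | insert i B hi ih =>
    intro x
    rw [Finset.sum_powerset_insert hi, ← ih x]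
    have h : ∑ A ∈ B.powerset, moebius x (insert i A) = diff i x B := by
      rw [ih (diff i x)]
      exact Finset.sum_congr rfl fun A hA =>
        moebius_insert x fun h => hi (Finset.mem_powerset.1 hA h)
    rw [h, diff]
    ring

theorem diff_eq_sum_moebius (x : Finset (Fin 4) → ZMod 8) {B : Finset (Fin 4)} (hi : i ∉ B) :
    diff i x B = ∑ A ∈ B.powerset, moebius x (insert i A) := by
  rw [eq_sum_moebius B (diff i x)]
  exact Finset.sum_congr rfl fun A hA =>
    (moebius_insert x fun h => hi (Finset.mem_powerset.1 hA h)).symm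

theorem diff_apply_of_mem (x : Finset (Fin 4) → ZMod 8) {B : Finset (Fin 4)} (hi : i ∈ B) :
    diff i x B = 0 := by
  rw [diff, Finset.insert_eq_of_mem hi, sub_self]

theorem diff_comm (i j : Fin 4) (x : Finset (Fin 4) → ZMod 8) :
    diff i (diff j x) = diff j (diff i x) := by
  funext B
  simp only [diff, Finset.insert_comm i j]
  ring

theorem diff_diff_eq_sum_moebius (x : Finset (Fin 4) → ZMod 8) {B : Finset (Fin 4)}
    (hij : i ≠ j) (hi : i ∉ B) (hj : j ∉ B) :
    diff i (diff j x) B = ∑ A ∈ B.powerset, moebius x (insert j (insert i A)) := by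
  rw [diff_eq_sum_moebius _ hi]
  refine Finset.sum_congr rfl fun A hA => (moebius_insert x ?_).symm
  rw [Finset.mem_insert, not_or]
  exact ⟨hij.symm, fun h => hj (Finset.mem_powerset.1 hA h)⟩

end Moebius

theorem const_mem_Z (c : ZMod 8) : (fun _ => c) ∈ Z := by
  have h : ∀ A : Finset (Fin 4), 2 ≤ A.card → A.Nonempty := fun A hA => Finset.card_pos.1 (by omega)
  refine ⟨?_, fun A hA => ?_, fun A hA _ => ?_, fun A hA _ => ?_⟩
  · simp [moebius_const]
  · simp [moebius_const c (h A hA)]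
  · simp [moebius_const c (h A hA)]
  · exact moebius_const c ⟨_, hA⟩

/-- The relation `Z` as a submodule. -/
def submoduleZ : Submodule (ZMod 8) (Finset (Fin 4) → ZMod 8) where
  carrier := Z
  zero_mem' := const_mem_Z 0
  add_mem' := by
    rintro x y ⟨⟨h1, h2⟩, h3, h4, h5⟩ ⟨⟨k1, k2⟩, k3, k4, k5⟩
    refine ⟨⟨?_, ?_⟩, fun A hA => ?_, fun A hA hA' => ?_, fun A hA hA' => ?_⟩ <;>
      simp only [moebius_add]
    · convert dvd_add h1 k1 using 1; ring
    · convert dvd_add h2 k2 using 1; ring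
    · exact dvd_add (h3 A hA) (k3 A hA)
    · exact dvd_add (h4 A hA hA') (k4 A hA hA')
    · rw [h5 A hA hA', k5 A hA hA', add_zero]
  smul_mem' := by
    rintro c x ⟨⟨h1, h2⟩, h3, h4, h5⟩
    refine ⟨⟨?_, ?_⟩, fun A hA => ?_, fun A hA hA' => ?_, fun A hA hA' => ?_⟩ <;>
      simp only [moebius_smul]
    · convert h1.mul_left c using 1; ring
    · convert h2.mul_left c using 1; ring
    · exact (h3 A hA).mul_left c
    · exact (h4 A hA hA').mul_left c
    · rw [h5 A hA hA', mul_zero]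

theorem mem_submoduleZ {x : Finset (Fin 4) → ZMod 8} : x ∈ submoduleZ ↔ x ∈ Z := Iff.rfl

/-- A subring containing `Z` whose double is contained in `Z`. -/
def subringZ : Subring (Finset (Fin 4) → ZMod 8) where
  carrier := {x | (∀ B, 2 ∣ diff 1 x B) ∧ (∀ B, 2 ∣ diff 3 x B) ∧ ∀ B, 4 ∣ diff 1 (diff 3 x) B}
  zero_mem' := by simp [diff]
  one_mem' := by simp [diff]
  add_mem' := by
    rintro x y ⟨h1, h2, h3⟩ ⟨k1, k2, k3⟩
    refine ⟨fun B => ?_, fun B => ?_, fun B => ?_⟩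
    · convert dvd_add (h1 B) (k1 B) using 1; simp only [diff, Pi.add_apply]; ring
    · convert dvd_add (h2 B) (k2 B) using 1; simp only [diff, Pi.add_apply]; ring
    · convert dvd_add (h3 B) (k3 B) using 1; simp only [diff, Pi.add_apply]; ring
  neg_mem' := by
    rintro x ⟨h1, h2, h3⟩
    refine ⟨fun B => ?_, fun B => ?_, fun B => ?_⟩
    · convert (h1 B).neg_right using 1; simp only [diff, Pi.neg_apply]; ring
    · convert (h2 B).neg_right using 1; simp only [diff, Pi.neg_apply]; ring
    · convert (h3 B).neg_right using 1; simp only [diff, Pi.neg_apply]; ring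
  mul_mem' := by
    rintro x y ⟨h1, h2, h3⟩ ⟨k1, k2, k3⟩
    refine ⟨fun B => ?_, fun B => ?_, fun B => ?_⟩
    · obtain ⟨a, ha⟩ := h1 B
      obtain ⟨b, hb⟩ := k1 B
      refine ⟨a * y (insert 1 B) + x B * b, ?_⟩
      simp only [diff, Pi.mul_apply] at *
      linear_combination y (insert 1 B) * ha + x B * hb
    · obtain ⟨a, ha⟩ := h2 B
      obtain ⟨b, hb⟩ := k2 B
      refine ⟨a * y (insert 3 B) + x B * b, ?_⟩
      simp only [diff, Pi.mul_apply] at *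
      linear_combination y (insert 3 B) * ha + x B * hb
    · obtain ⟨a, ha⟩ := h1 B
      obtain ⟨b, hb⟩ := k1 B
      obtain ⟨c, hc⟩ := h2 B
      obtain ⟨d, hd⟩ := k2 B
      obtain ⟨e, he⟩ := h3 B
      obtain ⟨f, hf⟩ := k3 B
      simp only [diff, Pi.mul_apply, Finset.insert_comm (3 : Fin 4) 1] at *
      -- The product rule for a mixed difference: besides the two terms with a mixed difference of
      -- one factor, there are products of two first differences, which are even times even.
      refine ⟨e * y (insert 1 (insert 3 B)) + a * (d + 2 * f) + c * (b + 2 * f) + x B * f, ?_⟩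
      linear_combination y (insert 1 (insert 3 B)) * he + x B * hf +
        (y (insert 1 (insert 3 B)) - y (insert 1 B)) * ha +
        (y (insert 1 (insert 3 B)) - y (insert 3 B)) * hc + 2 * a * (hf + hd) + 2 * c * (hf + hb)

/-- A difference in direction 1 is a sum of coordinates at sets containing 1: the one at `{1}` is
even because it is `2 a` mod 4, the others are divisible by 4. Direction 3 is symmetric, and the
mixed difference involves only coordinates at sets containing both, which vanish. -/
theorem Z_subset_subringZ {x : Finset (Fin 4) → ZMod 8} (hx : x ∈ Z) : x ∈ subringZ := by
  obtain ⟨⟨h1, h2⟩, -, h4, h5⟩ := hx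
  have key : ∀ i k : Fin 4, (4 ∣ moebius x {i} - 2 * moebius x {k}) → (i = 1 ∨ i = 3) →
      ∀ B, 2 ∣ diff i x B := by
    intro i k hik hi B
    by_cases hB : i ∈ B
    · rw [diff_apply_of_mem x hB]; exact dvd_zero _
    rw [diff_eq_sum_moebius x hB]
    refine Finset.dvd_sum fun A hA => ?_
    have hiA : i ∉ A := fun h => hB (Finset.mem_powerset.1 hA h)
    rcases A.eq_empty_or_nonempty with rfl | hne
    · obtain ⟨c, hc⟩ := hik
      exact ⟨moebius x {k} + 2 * c, by rw [insert_empty_eq]; linear_combination hc⟩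
    · refine Dvd.dvd.trans ⟨2, by norm_num⟩ (h4 _ ?_ ?_)
      · rw [Finset.card_insert_of_notMem hiA]; have := hne.card_pos; omega
      · rcases hi with rfl | rfl <;> simp
  refine ⟨key 1 0 h1 (by simp), key 3 2 h2 (by simp), fun B => ?_⟩
  by_cases hB : 1 ∈ B
  · rw [diff_apply_of_mem _ hB]; exact dvd_zero _
  by_cases hB' : 3 ∈ B
  · rw [diff_comm, diff_apply_of_mem _ hB']; exact dvd_zero _
  rw [diff_diff_eq_sum_moebius x (by decide) hB hB', Finset.sum_eq_zero fun A _ => h5 _ ?_ ?_]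
  · exact dvd_zero _
  · simp
  · simp

theorem two_smul_mem_Z {x : Finset (Fin 4) → ZMod 8} (hx : x ∈ subringZ) :
    (2 : ZMod 8) • x ∈ Z := by
  obtain ⟨h1, h2, h3⟩ := hx
  have k1 : ∀ A : Finset (Fin 4), 1 ∈ A → 2 ∣ moebius x A := fun A hA => by
    rw [← Finset.insert_erase hA, moebius_insert x (Finset.notMem_erase _ _)]
    exact dvd_moebius h1 _
  have k2 : ∀ A : Finset (Fin 4), 3 ∈ A → 2 ∣ moebius x A := fun A hA => by
    rw [← Finset.insert_erase hA, moebius_insert x (Finset.notMem_erase _ _)]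
    exact dvd_moebius h2 _
  have e : ∀ y : ZMod 8, 2 ∣ y → 4 ∣ 2 * y := fun y ⟨c, hc⟩ => ⟨c, by rw [hc]; ring⟩
  refine ⟨⟨?_, ?_⟩, fun A hA => ?_, fun A hA hA' => ?_, fun A hA hA' => ?_⟩ <;>
    simp only [moebius_smul]
  · exact dvd_sub (e _ (k1 _ (by simp))) ⟨moebius x {0}, by ring⟩
  · exact dvd_sub (e _ (k2 _ (by simp))) ⟨moebius x {2}, by ring⟩
  · exact Dvd.intro _ rfl
  · exact e _ (hA'.elim (k1 A) (k2 A))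
  · rw [← Finset.insert_erase hA', moebius_insert x (Finset.notMem_erase _ _),
      ← Finset.insert_erase (Finset.mem_erase.2 ⟨by decide, hA⟩),
      moebius_insert _ (Finset.notMem_erase _ _)]
    obtain ⟨c, hc⟩ := dvd_moebius h3 ((A.erase 3).erase 1)
    rw [hc, ← mul_assoc, show (2 * 4 : ZMod 8) = 0 by decide, zero_mul]

/-- The tuple `g^{i} + 2 g^{j}`. -/
def direction (i j : Fin 4) (B : Finset (Fin 4)) : ZMod 8 :=
  (if i ∈ B then 1 else 0) + if j ∈ B then 2 else 0

theorem direction_mem_Z : direction 0 1 ∈ Z ∧ direction 2 3 ∈ Z := by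
  have h1 : ∀ A : Finset (Fin 4), 2 ≤ A.card → moebius (direction 0 1) A = 0 := by
    unfold moebius direction; decide
  have h2 : ∀ A : Finset (Fin 4), 2 ≤ A.card → moebius (direction 2 3) A = 0 := by
    unfold moebius direction; decide
  have h3 : ∀ A : Finset (Fin 4), 1 ∈ A → 3 ∈ A → 2 ≤ A.card := by decide
  refine ⟨⟨⟨?_, ?_⟩, fun A hA => ?_, fun A hA _ => ?_, fun A hA hA' => ?_⟩,
    ⟨⟨?_, ?_⟩, fun A hA => ?_, fun A hA _ => ?_, fun A hA hA' => ?_⟩⟩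
  · simp [moebius_singleton, direction]
  · simp [moebius_singleton, direction]
  · simp [h1 A hA]
  · simp [h1 A hA]
  · exact h1 A (h3 A hA hA')
  · simp [moebius_singleton, direction]
  · simp [moebius_singleton, direction]
  · simp [h2 A hA]
  · simp [h2 A hA]
  · exact h2 A (h3 A hA hA')

end CloneZ8

namespace CloneZ8

/-! ### Polynomials whose nonlinear coefficients are even -/

/-- The operations given by polynomials in which every monomial of degree at least `2` has an
even coefficient. -/
def HasEvenNonlinear {n : ℕ} (f : Op (ZMod 8) n) : Prop :=
  ∃ P : MvPolynomial (Fin n) (ZMod 8),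
    (∀ α, 2 ≤ α.degree → Even (P.coeff α)) ∧ ∀ x, f x = MvPolynomial.eval x P

theorem eq_zero_or_single_of_degree_lt_two {σ : Type*} {α : σ →₀ ℕ} (h : α.degree < 2) :
    α = 0 ∨ ∃ i, α = Finsupp.single i 1 := by
  by_cases h0 : α = 0
  · exact Or.inl h0
  obtain ⟨i, hi⟩ := Finsupp.ne_iff.1 h0
  have hle : Finsupp.single i 1 ≤ α := by
    rw [Finsupp.single_le_iff]; exact Nat.one_le_iff_ne_zero.2 hi
  have hd := congrArg Finsupp.degree (add_tsub_cancel_of_le hle)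
  rw [map_add, Finsupp.degree_single] at hd
  have h1 : (α - Finsupp.single i 1).degree = 0 := by omega
  rw [Finsupp.degree_eq_zero_iff] at h1
  refine Or.inr ⟨i, ?_⟩
  rw [← add_tsub_cancel_of_le hle, h1, add_zero]

namespace HasEvenNonlinear

variable {n : ℕ}

theorem zero : HasEvenNonlinear (fun _ : Fin n → ZMod 8 => 0) := ⟨0, by simp, by simp⟩

theorem add {f g : Op (ZMod 8) n} (hf : HasEvenNonlinear f) (hg : HasEvenNonlinear g) :
    HasEvenNonlinear fun x => f x + g x := by
  obtain ⟨P, hP, hf⟩ := hf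
  obtain ⟨Q, hQ, hg⟩ := hg
  refine ⟨P + Q, fun α hα => ?_, fun x => by simp [hf, hg]⟩
  rw [MvPolynomial.coeff_add]
  exact (hP α hα).add (hQ α hα)

theorem sum {ι : Type*} (S : Finset ι) {f : ι → Op (ZMod 8) n}
    (h : ∀ i ∈ S, HasEvenNonlinear (f i)) : HasEvenNonlinear fun x => ∑ i ∈ S, f i x := by
  classical
  induction S using Finset.induction_on with
  | empty => simpa using zero
  | insert i S hi ih =>
    simp only [Finset.sum_insert hi]
    exact (h i (by simp)).add (ih fun j hj => h j (by simp [hj]))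

theorem of_even {c : ZMod 8} (hc : Even c) (P : MvPolynomial (Fin n) (ZMod 8)) :
    HasEvenNonlinear fun x => c * MvPolynomial.eval x P := by
  refine ⟨MvPolynomial.C c * P, fun α _ => ?_, fun x => by simp⟩
  rw [MvPolynomial.coeff_C_mul]
  exact hc.mul_right _

theorem const (c : ZMod 8) : HasEvenNonlinear (fun _ : Fin n → ZMod 8 => c) := by
  classical
  refine ⟨MvPolynomial.C c, fun α hα => ?_, fun x => by simp⟩
  rw [MvPolynomial.coeff_C, if_neg]
  · simp
  · rintro rfl; simp at hα

theorem const_mul_var (c : ZMod 8) (i : Fin n) : HasEvenNonlinear fun x => c * x i := by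
  classical
  refine ⟨MvPolynomial.C c * MvPolynomial.X i, fun α hα => ?_, fun x => by simp⟩
  rw [MvPolynomial.coeff_C_mul, MvPolynomial.coeff_X, if_neg]
  · simp
  · rintro rfl; simp at hα

theorem preserves {f : Op (ZMod 8) n} (hf : HasEvenNonlinear f) : Preserves f Z := by
  obtain ⟨P, hP, hf⟩ := hf
  intro u hu
  have h : (fun B => f fun i => u i B) =
      ∑ α ∈ P.support, P.coeff α • ∏ i, u i ^ α i := by
    funext B
    rw [hf, MvPolynomial.eval_eq']
    simp [Finset.sum_apply, Finset.prod_apply]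
  rw [h, ← mem_submoduleZ]
  refine Submodule.sum_mem _ fun α _ => ?_
  rcases lt_or_ge α.degree 2 with hα | hα
  · refine Submodule.smul_mem _ _ ?_
    -- Monomials of degree at most 1 need only that `Z` is a submodule with the constants; the even
    -- coefficient is used in the other case.
    rcases eq_zero_or_single_of_degree_lt_two hα with rfl | ⟨i, rfl⟩
    · simp only [Finsupp.coe_zero, Pi.zero_apply, pow_zero, Finset.prod_const_one]
      exact const_mem_Z 1
    · rw [Finset.prod_eq_single i]
      · rw [Finsupp.single_eq_same, pow_one]
        exact hu i
      · intro j _ hj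
        simp [hj]
      · simp
  · obtain ⟨c, hc⟩ := hP α hα
    rw [hc, ← mul_two, mul_smul]
    refine Submodule.smul_mem _ _ (two_smul_mem_Z ?_)
    exact Subring.prod_mem _ fun i _ => Subring.pow_mem _ (Z_subset_subringZ (hu i)) _

end HasEvenNonlinear

/-! ### Finite differences and falling factorials -/

variable {n : ℕ}

/-- The forward difference of `f` in the variable `i`. -/
def fdiff (i : Fin n) (f : Op (ZMod 8) n) : Op (ZMod 8) n :=
  fun x => f (x + Pi.single i 1) - f x

theorem fdiff_comm (i j : Fin n) (f : Op (ZMod 8) n) :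
    fdiff i (fdiff j f) = fdiff j (fdiff i f) := by
  funext x
  simp only [fdiff, add_right_comm x (Pi.single i 1)]
  ring

/-- The divisibility conditions on iterated differences that follow from the preservation
of `Z`. -/
structure DiffDvd (f : Op (ZMod 8) n) : Prop where
  two : ∀ i j, i ≠ j → ∀ x, 2 ∣ fdiff i (fdiff j f) x
  four : ∀ i x, 4 ∣ fdiff i (fdiff i f) x
  eight : ∀ i j, i ≠ j → ∀ x, fdiff i (fdiff i (fdiff j (fdiff j f))) x = 0

theorem DiffDvd.fdiff {f : Op (ZMod 8) n} (h : DiffDvd f) (k : Fin n) :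
    DiffDvd (fdiff k f) where
  two i j hij x := by
    rw [fdiff_comm j k, fdiff_comm i k]
    exact dvd_sub (h.two i j hij _) (h.two i j hij _)
  four i x := by
    rw [fdiff_comm i k, fdiff_comm i k]
    exact dvd_sub (h.four i _) (h.four i _)
  eight i j hij x := by
    rw [fdiff_comm j k, fdiff_comm j k, fdiff_comm i k, fdiff_comm i k, CloneZ8.fdiff,
      h.eight i j hij, h.eight i j hij, sub_zero]

/-- In the tuples used, indices 0 and 1 add 1 and 2 to `x i`, while indices 2 and 3 add 1 and 2 to
`x j`. The coordinates of the image are therefore differences of `f` with step 1 or 2. -/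
theorem diffDvd_of_preserves {f : Op (ZMod 8) n} (hf : Preserves f Z) : DiffDvd f := by
  have key : ∀ (i j : Fin n) (x : Fin n → ZMod 8),
      (fun B => f (x + Pi.single i (direction 0 1 B) + Pi.single j (direction 2 3 B))) ∈ Z := by
    intro i j x
    refine hf (fun m B => x m + (Pi.single i (direction 0 1 B) : Fin n → ZMod 8) m +
      (Pi.single j (direction 2 3 B) : Fin n → ZMod 8) m) fun m => ?_
    have e : ∀ (k : Fin n) {d : Finset (Fin 4) → ZMod 8}, d ∈ Z →
        (fun B => (Pi.single k (d B) : Fin n → ZMod 8) m) ∈ submoduleZ := by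
      intro k d hd
      by_cases hm : m = k
      · subst hm
        simp only [Pi.single_eq_same]
        exact hd
      · simp only [Pi.single_eq_of_ne hm]
        exact const_mem_Z 0
    exact submoduleZ.add_mem (submoduleZ.add_mem (const_mem_Z (x m)) (e i direction_mem_Z.1))
      (e j direction_mem_Z.2)
  have two_single : ∀ i : Fin n, (Pi.single i 2 : Fin n → ZMod 8) =
      Pi.single i 1 + Pi.single i 1 := fun i => by
    rw [← Pi.single_add]; norm_num
  have two : ∀ i j, i ≠ j → ∀ x, 2 ∣ fdiff i (fdiff j f) x := by
    intro i j hij x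
    have h := (key i j x).2.1 {0, 2} (by decide)
    rw [moebius_pair _ (by decide)] at h
    simp only [direction] at h
    simp at h
    simp only [fdiff]
    convert h using 1
    ring
  have four : ∀ i x, 4 ∣ fdiff i (fdiff i f) x := by
    intro i x
    have h := (key i i x).1.1
    rw [moebius_singleton, moebius_singleton] at h
    simp only [direction] at h
    simp [two_single, ← add_assoc] at h
    simp only [fdiff]
    convert h using 1
    ring
  -- The coordinate at `{1, 3}` is the mixed difference with steps 2, that is `(Δᵢ² + 2 Δᵢ)(Δⱼ² + 2
  -- Δⱼ) f`. By the two conditions already proved, all terms except `Δᵢ² Δⱼ² f` are multiples of 8.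
  refine ⟨two, four, fun i j hij x => ?_⟩
  have h := (key i j x).2.2.2 {1, 3} (by decide) (by decide)
  rw [moebius_pair _ (by decide)] at h
  simp only [direction] at h
  simp [two_single, ← add_assoc] at h
  obtain ⟨a, ha⟩ := four i x
  obtain ⟨b, hb⟩ := four j x
  obtain ⟨c, hc⟩ := four j (x + Pi.single i 1)
  obtain ⟨d, hd⟩ := two i j hij x
  obtain ⟨e, he⟩ := four i (x + Pi.single j 1)
  have h8 : (8 : ZMod 8) = 0 := by decide
  simp only [fdiff, add_right_comm _ (Pi.single j 1) (Pi.single i 1)] at *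
  linear_combination h - 2 * hc + 2 * hb - 4 * hd + 2 * ha - 2 * he + (-c + b - d + a - e) * h8

/-- The falling factorial `x (x - 1) ⋯ (x - k + 1)`. -/
noncomputable def falling (k : ℕ) (x : ZMod 8) : ZMod 8 := (descPochhammer (ZMod 8) k).eval x

theorem falling_zero (x : ZMod 8) : falling 0 x = 1 := by simp [falling]

theorem falling_succ (k : ℕ) (x : ZMod 8) : falling (k + 1) x = falling k x * (x - k) := by
  simp [falling, descPochhammer_succ_right]

theorem falling_one (x : ZMod 8) : falling 1 x = x := by
  rw [falling_succ, falling_zero]; simp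

theorem falling_add_one (k : ℕ) (x : ZMod 8) :
    falling k (x + 1) = falling k x + k * falling (k - 1) x := by
  cases k with
  | zero => simp [falling_zero]
  | succ k =>
    have h : falling (k + 1) (x + 1) = (x + 1) * falling k x := by
      simp [falling, descPochhammer_succ_left]
    rw [h, falling_succ, Nat.add_sub_cancel]
    push_cast
    ring

/-- On natural representatives this is the integrality of binomial coefficients. -/
theorem factorial_dvd_falling (k : ℕ) (x : ZMod 8) : (k.factorial : ZMod 8) ∣ falling k x := by
  have h := descPochhammer_eval_eq_descFactorial (ZMod 8) x.val k
  rw [ZMod.natCast_zmod_val] at h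
  rw [falling, h]
  exact Nat.cast_dvd_cast (Nat.factorial_dvd_descFactorial _ _)

/-- The product of falling factorials with exponents `k`. -/
noncomputable def fallingProd (k : Fin n →₀ ℕ) : Op (ZMod 8) n := fun x => ∏ i, falling (k i) (x i)

theorem fallingProd_add_single (k : Fin n →₀ ℕ) (i : Fin n) (x : Fin n → ZMod 8) :
    fallingProd (k + Finsupp.single i 1) x = fallingProd k x * (x i - k i) := by
  unfold fallingProd
  rw [← Finset.mul_prod_erase _ _ (Finset.mem_univ i),
    ← Finset.mul_prod_erase _ (fun j => falling (k j) (x j)) (Finset.mem_univ i)]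
  rw [Finset.prod_congr rfl fun j hj => by
    rw [Finsupp.add_apply, Finsupp.single_eq_of_ne (Finset.ne_of_mem_erase hj), add_zero]]
  rw [Finsupp.add_apply, Finsupp.single_eq_same, falling_succ]
  ring

theorem fdiff_fallingProd (k : Fin n →₀ ℕ) (i : Fin n) :
    fdiff i (fallingProd k) = (k i : ZMod 8) • fallingProd (k - Finsupp.single i 1) := by
  funext x
  simp only [fdiff, fallingProd, Pi.smul_apply, smul_eq_mul]
  have h : ∀ g : Fin n → ZMod 8, ∏ j, g j = g i * ∏ j ∈ Finset.univ.erase i, g j := fun g =>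
    (Finset.mul_prod_erase _ _ (Finset.mem_univ i)).symm
  have e : ∏ j ∈ Finset.univ.erase i, falling ((k - Finsupp.single i 1 : Fin n →₀ ℕ) j) (x j) =
      ∏ j ∈ Finset.univ.erase i, falling (k j) (x j) := Finset.prod_congr rfl fun j hj => by
    rw [Finsupp.tsub_apply, Finsupp.single_eq_of_ne (Finset.ne_of_mem_erase hj), tsub_zero]
  rw [h, h fun j => falling (k j) (x j), h]
  rw [Finset.prod_congr rfl fun j hj => by
      rw [Pi.add_apply, Pi.single_eq_of_ne (Finset.ne_of_mem_erase hj), add_zero],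
    e]
  rw [Pi.add_apply, Pi.single_eq_same, Finsupp.tsub_apply, Finsupp.single_eq_same,
    falling_add_one]
  ring

/-- The linear map that sends each monomial to the corresponding product of falling
factorials. -/
noncomputable def umbral (n : ℕ) : MvPolynomial (Fin n) (ZMod 8) →ₗ[ZMod 8] Op (ZMod 8) n :=
  (MvPolynomial.basisMonomials (Fin n) (ZMod 8)).constr (ZMod 8) fallingProd

theorem umbral_monomial (k : Fin n →₀ ℕ) (c : ZMod 8) :
    umbral n (MvPolynomial.monomial k c) = c • fallingProd k := by
  have h := (MvPolynomial.basisMonomials (Fin n) (ZMod 8)).constr_basis (ZMod 8) fallingProd k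
  rw [MvPolynomial.coe_basisMonomials] at h
  rw [← mul_one c, ← smul_eq_mul, ← MvPolynomial.smul_monomial, map_smul, smul_eq_mul, mul_one]
  exact congrArg (c • ·) h

theorem umbral_apply (P : MvPolynomial (Fin n) (ZMod 8)) (x : Fin n → ZMod 8) :
    umbral n P x = ∑ k ∈ P.support, P.coeff k * fallingProd k x := by
  conv_lhs => rw [P.as_sum]
  rw [map_sum, Finset.sum_apply]
  exact Finset.sum_congr rfl fun k _ => by rw [umbral_monomial]; rfl

theorem fdiff_umbral (i : Fin n) (P : MvPolynomial (Fin n) (ZMod 8)) :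
    fdiff i (umbral n P) = umbral n (MvPolynomial.pderiv i P) := by
  induction P using MvPolynomial.induction_on' with
  | monomial k c =>
    rw [MvPolynomial.pderiv_monomial, umbral_monomial, umbral_monomial, mul_smul,
      ← fdiff_fallingProd]
    funext x
    simp only [fdiff, Pi.smul_apply, smul_eq_mul]
    ring
  | add P Q hP hQ =>
    rw [map_add, map_add, map_add, ← hP, ← hQ]
    funext x
    simp only [fdiff, Pi.add_apply]
    ring

theorem umbral_zero (P : MvPolynomial (Fin n) (ZMod 8)) : umbral n P 0 = P.coeff 0 := by
  rw [umbral_apply]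
  have h0 : ∀ k : Fin n →₀ ℕ, k ≠ 0 → fallingProd k 0 = 0 := by
    intro k hk
    obtain ⟨i, hi⟩ := Finsupp.ne_iff.1 hk
    refine Finset.prod_eq_zero (Finset.mem_univ i) ?_
    simpa [falling] using descPochhammer_ne_zero_eval_zero (ZMod 8) hi
  rw [Finset.sum_eq_single 0]
  · simp [fallingProd, falling_zero]
  · intro k _ hk
    rw [h0 k hk, mul_zero]
  · intro h
    rw [MvPolynomial.notMem_support_iff.1 h, zero_mul]

/-- Falling factorials span because multiplying by `x i` sends the product with exponents `k` to the
one with `k i` raised by 1, plus `k i` times itself. -/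
theorem exists_umbral_eq (P : MvPolynomial (Fin n) (ZMod 8)) :
    ∃ Q, umbral n Q = fun x => MvPolynomial.eval x P := by
  induction P using MvPolynomial.induction_on with
  | C a =>
    refine ⟨MvPolynomial.monomial 0 a, ?_⟩
    rw [umbral_monomial]
    funext x
    simp [fallingProd, falling_zero]
  | add P Q hP hQ =>
    obtain ⟨P', hP⟩ := hP
    obtain ⟨Q', hQ⟩ := hQ
    refine ⟨P' + Q', ?_⟩
    rw [map_add, hP, hQ]
    funext x
    simp
  | mul_X P i hP =>
    obtain ⟨P', hP⟩ := hP
    have h : ∀ Q : MvPolynomial (Fin n) (ZMod 8), ∃ Q', umbral n Q' =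
        fun x => umbral n Q x * x i := by
      intro Q
      refine ⟨∑ k ∈ Q.support, (MvPolynomial.monomial (k + Finsupp.single i 1) (Q.coeff k) +
        MvPolynomial.monomial k (Q.coeff k * k i)), ?_⟩
      funext x
      rw [map_sum, Finset.sum_apply, umbral_apply, Finset.sum_mul]
      refine Finset.sum_congr rfl fun k _ => ?_
      rw [map_add, umbral_monomial, umbral_monomial]
      simp only [Pi.add_apply, Pi.smul_apply, smul_eq_mul, fallingProd_add_single]
      ring
    obtain ⟨Q', hQ'⟩ := h P'
    refine ⟨Q', ?_⟩
    rw [hQ', hP]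
    funext x
    simp

/-- The product of the factorials of the exponents. -/
def factorialProd (k : Fin n →₀ ℕ) : ZMod 8 := ∏ i, ((k i).factorial : ZMod 8)

theorem factorialProd_add_single (k : Fin n →₀ ℕ) (i : Fin n) :
    factorialProd (k + Finsupp.single i 1) = factorialProd k * (k i + 1) := by
  unfold factorialProd
  rw [← Finset.mul_prod_erase _ _ (Finset.mem_univ i),
    ← Finset.mul_prod_erase _ (fun j => ((k j).factorial : ZMod 8)) (Finset.mem_univ i)]
  rw [Finset.prod_congr rfl fun j hj => by
    rw [Finsupp.add_apply, Finsupp.single_eq_of_ne (Finset.ne_of_mem_erase hj), add_zero]]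
  rw [Finsupp.add_apply, Finsupp.single_eq_same, Nat.factorial_succ]
  push_cast
  ring

theorem factorialProd_mul_coeff_add_single (k : Fin n →₀ ℕ) (i : Fin n)
    (P : MvPolynomial (Fin n) (ZMod 8)) :
    factorialProd (k + Finsupp.single i 1) * P.coeff (k + Finsupp.single i 1) =
      factorialProd k * (MvPolynomial.pderiv i P).coeff k := by
  rw [factorialProd_add_single, MvPolynomial.coeff_pderiv]
  ring

theorem factorialProd_zero : factorialProd (0 : Fin n →₀ ℕ) = 1 := by
  simp [factorialProd]

/-- Up to factorials, a coefficient at `b + l` is the coefficient at `b` of an iterated derivative.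
Derivatives are differences, and these keep `DiffDvd`; so it suffices to treat the minimal exponent
`b`, for all polynomials at once. -/
theorem dvd_factorialProd_mul_coeff {d : ZMod 8} {b k : Fin n →₀ ℕ} (hbk : b ≤ k)
    (hb : ∀ P : MvPolynomial (Fin n) (ZMod 8), DiffDvd (umbral n P) →
      d ∣ factorialProd b * P.coeff b)
    {P : MvPolynomial (Fin n) (ZMod 8)} (hP : DiffDvd (umbral n P)) :
    d ∣ factorialProd k * P.coeff k := by
  obtain ⟨l, rfl⟩ := le_iff_exists_add.1 hbk
  clear hbk
  obtain ⟨m, hm⟩ : ∃ m, l.degree = m := ⟨_, rfl⟩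
  induction m generalizing l P with
  | zero =>
    rw [(Finsupp.degree_eq_zero_iff l).1 hm, add_zero]
    exact hb P hP
  | succ m ih =>
    have h0 : l ≠ 0 := by rintro rfl; simp at hm
    obtain ⟨i, hi⟩ := Finsupp.ne_iff.1 h0
    have hle : Finsupp.single i 1 ≤ l := by
      rw [Finsupp.single_le_iff]; exact Nat.one_le_iff_ne_zero.2 hi
    obtain ⟨l', rfl⟩ := le_iff_exists_add'.1 hle
    rw [map_add, Finsupp.degree_single] at hm
    rw [← add_assoc, factorialProd_mul_coeff_add_single]
    refine ih (P := MvPolynomial.pderiv i P) ?_ l' (by omega)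
    rw [← fdiff_umbral]
    exact hP.fdiff i

theorem two_dvd_factorialProd_mul_coeff {P : MvPolynomial (Fin n) (ZMod 8)}
    (hP : DiffDvd (umbral n P)) {k : Fin n →₀ ℕ} {i j : Fin n} (hij : i ≠ j) (hi : 1 ≤ k i)
    (hj : 1 ≤ k j) : 2 ∣ factorialProd k * P.coeff k := by
  refine dvd_factorialProd_mul_coeff (b := 0 + Finsupp.single j 1 + Finsupp.single i 1) ?_
    (fun Q hQ => ?_) hP
  · intro m
    by_cases h1 : m = i <;> by_cases h2 : m = j <;> simp_all
  · rw [factorialProd_mul_coeff_add_single, factorialProd_mul_coeff_add_single,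
      factorialProd_zero, one_mul, ← umbral_zero, ← fdiff_umbral, ← fdiff_umbral]
    exact hQ.two j i hij.symm 0

theorem four_dvd_factorialProd_mul_coeff {P : MvPolynomial (Fin n) (ZMod 8)}
    (hP : DiffDvd (umbral n P)) {k : Fin n →₀ ℕ} {i : Fin n} (hi : 2 ≤ k i) :
    4 ∣ factorialProd k * P.coeff k := by
  refine dvd_factorialProd_mul_coeff (b := 0 + Finsupp.single i 1 + Finsupp.single i 1) ?_
    (fun Q hQ => ?_) hP
  · rw [zero_add, ← Finsupp.single_add, Finsupp.single_le_iff]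
    exact hi
  · rw [factorialProd_mul_coeff_add_single, factorialProd_mul_coeff_add_single,
      factorialProd_zero, one_mul, ← umbral_zero, ← fdiff_umbral, ← fdiff_umbral]
    exact hQ.four i 0

theorem factorialProd_mul_coeff_eq_zero {P : MvPolynomial (Fin n) (ZMod 8)}
    (hP : DiffDvd (umbral n P)) {k : Fin n →₀ ℕ} {i j : Fin n} (hij : i ≠ j) (hi : 2 ≤ k i)
    (hj : 2 ≤ k j) : factorialProd k * P.coeff k = 0 := by
  rw [← zero_dvd_iff]
  refine dvd_factorialProd_mul_coeff (b := 0 + Finsupp.single j 1 + Finsupp.single j 1 +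
    Finsupp.single i 1 + Finsupp.single i 1) ?_ (fun Q hQ => ?_) hP
  · intro m
    by_cases h1 : m = i <;> by_cases h2 : m = j <;> simp_all
  · rw [factorialProd_mul_coeff_add_single, factorialProd_mul_coeff_add_single,
      factorialProd_mul_coeff_add_single, factorialProd_mul_coeff_add_single,
      factorialProd_zero, one_mul, ← umbral_zero, ← fdiff_umbral, ← fdiff_umbral, ← fdiff_umbral,
      ← fdiff_umbral, zero_dvd_iff]
    exact hQ.eight j i hij.symm 0

theorem even_or_mul_eq_zero (a c : ZMod 8) (h : a * c = 0) : Even c ∨ a = 0 := by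
  rw [even_iff_two_dvd]; revert a c; decide

theorem even_or_four_dvd (a c : ZMod 8) (h : 4 ∣ a * c) : Even c ∨ 4 ∣ a := by
  rw [even_iff_two_dvd]; revert a c; decide

theorem factorial_eq_zero {m : ℕ} (hm : 4 ≤ m) : (m.factorial : ZMod 8) = 0 := by
  have h : (8 : ℕ) ∣ m.factorial := Dvd.dvd.trans (by decide) (Nat.factorial_dvd_factorial hm)
  exact (ZMod.natCast_eq_zero_iff _ _).2 h

/-- An odd coefficient is a unit. With two exponents at least 2 this forces `k! = 0`. With exactly
one such exponent it forces `4 ∣ (k i)!`, hence `k i ≥ 4` and `8 ∣ (k i)!`. If all exponents are at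
most 1, then two of them are 1 and `k! = 1`, so the coefficient is even. -/
theorem even_coeff_or_factorialProd_eq_zero {P : MvPolynomial (Fin n) (ZMod 8)}
    (hP : DiffDvd (umbral n P)) {k : Fin n →₀ ℕ} (hk : 2 ≤ k.degree) :
    Even (P.coeff k) ∨ factorialProd k = 0 := by
  by_cases h2 : ∃ i, 2 ≤ k i
  · obtain ⟨i, hi⟩ := h2
    by_cases h3 : ∃ j, i ≠ j ∧ 2 ≤ k j
    · obtain ⟨j, hij, hj⟩ := h3
      exact even_or_mul_eq_zero _ _ (factorialProd_mul_coeff_eq_zero hP hij hi hj)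
    · push Not at h3
      have hf : factorialProd k = (k i).factorial := by
        unfold factorialProd
        refine Finset.prod_eq_single i (fun j _ hj => ?_) (by simp)
        have := h3 j hj.symm
        rw [Nat.factorial_eq_one.2 (by omega), Nat.cast_one]
      refine (even_or_four_dvd _ _ (four_dvd_factorialProd_mul_coeff hP hi)).imp_right fun h => ?_
      rw [hf] at h ⊢
      refine factorial_eq_zero ?_
      by_contra hlt
      have : k i = 2 ∨ k i = 3 := by omega
      rcases this with h' | h' <;> rw [h'] at h <;> revert h <;> decide
  · push Not at h2
    have hf : factorialProd k = 1 := by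
      unfold factorialProd
      refine Finset.prod_eq_one fun j _ => ?_
      have := h2 j
      rw [Nat.factorial_eq_one.2 (by omega), Nat.cast_one]
    obtain ⟨i, hi⟩ : ∃ i, k i ≠ 0 := by
      by_contra! h
      rw [(Finsupp.ext h : k = 0)] at hk
      simp at hk
    obtain ⟨j, hij, hj⟩ : ∃ j, i ≠ j ∧ k j ≠ 0 := by
      by_contra! h
      have : k = Finsupp.single i (k i) := by
        ext j
        by_cases hij : i = j
        · subst hij; simp
        · rw [h j hij, Finsupp.single_eq_of_ne (Ne.symm hij)]
      rw [this, Finsupp.degree_single] at hk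
      have := h2 i
      omega
    have h := two_dvd_factorialProd_mul_coeff hP hij (Nat.one_le_iff_ne_zero.2 hi)
      (Nat.one_le_iff_ne_zero.2 hj)
    rw [hf, one_mul] at h
    exact Or.inl (even_iff_two_dvd.2 h)

theorem fallingProd_eq_eval (k : Fin n →₀ ℕ) :
    ∃ P : MvPolynomial (Fin n) (ZMod 8), ∀ x, fallingProd k x = MvPolynomial.eval x P := by
  refine ⟨∏ i, Polynomial.aeval (MvPolynomial.X i) (descPochhammer (ZMod 8) (k i)), fun x => ?_⟩
  rw [map_prod]
  refine Finset.prod_congr rfl fun i _ => ?_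
  rw [falling, Polynomial.aeval_def, Polynomial.hom_eval₂, MvPolynomial.eval_X]
  have h : (MvPolynomial.eval x).comp (algebraMap (ZMod 8) (MvPolynomial (Fin n) (ZMod 8))) =
      RingHom.id _ := Subsingleton.elim _ _
  rw [h, Polynomial.eval₂_id]

theorem hasEvenNonlinear_of_preserves {f : Op (ZMod 8) n} {P : MvPolynomial (Fin n) (ZMod 8)}
    (hf : ∀ x, f x = MvPolynomial.eval x P) (h : Preserves f Z) : HasEvenNonlinear f := by
  obtain ⟨Q, hQ⟩ := exists_umbral_eq P
  have hfQ : f = umbral n Q := by rw [hQ]; exact funext hf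
  subst hfQ
  have hd := diffDvd_of_preserves h
  rw [show umbral n Q = fun x => ∑ k ∈ Q.support, Q.coeff k * fallingProd k x from
    funext (umbral_apply Q)]
  refine HasEvenNonlinear.sum _ fun k _ => ?_
  rcases lt_or_ge k.degree 2 with hk | hk
  · rcases eq_zero_or_single_of_degree_lt_two hk with rfl | ⟨i, rfl⟩
    · simpa [fallingProd, falling_zero] using HasEvenNonlinear.const (Q.coeff 0)
    · convert HasEvenNonlinear.const_mul_var (Q.coeff (Finsupp.single i 1)) i using 3 with x
      unfold fallingProd
      rw [Finset.prod_eq_single i (fun j _ hj => ?_) (by simp), Finsupp.single_eq_same,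
        falling_one]
      rw [Finsupp.single_eq_of_ne hj, falling_zero]
  · rcases even_coeff_or_factorialProd_eq_zero hd hk with he | h0
    · obtain ⟨R, hR⟩ := fallingProd_eq_eval k
      simpa only [hR] using HasEvenNonlinear.of_even he R
    -- The odd coefficient is harmless here: the function it multiplies is divisible by `k! = 0`.
    · have : ∀ x, fallingProd k x = 0 := fun x => by
        rw [← zero_dvd_iff, ← h0]
        exact Finset.prod_dvd_prod_of_dvd _ _ fun i _ => factorial_dvd_falling _ _
      simpa [this] using HasEvenNonlinear.zero

theorem mem_M₁_iff {f : Op (ZMod 8) n} : f ∈ M₁.ops n ↔ 0 < n ∧ HasEvenNonlinear f :=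
  ⟨fun ⟨⟨hn, _, hP⟩, h⟩ => ⟨hn, hasEvenNonlinear_of_preserves hP h⟩,
    fun ⟨hn, h⟩ => ⟨⟨hn, h.imp fun _ hP => hP.2⟩, h.preserves⟩⟩

end CloneZ8

namespace CloneZ8

/-! ### Operations in infinitely many variables -/

/-- Functions of countably many variables. -/
abbrev Fn : Type := (ℕ → ZMod 8) → ZMod 8

/-- An operation as a function of the first `n` of countably many variables. -/
def lift {n : ℕ} (f : Op (ZMod 8) n) : Fn := fun x => f fun i => x i

/-- Groups of functions closed under substitution, containing the variables and constants. -/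
structure Closed (L : AddSubgroup Fn) : Prop where
  const : ∀ c : ZMod 8, (fun _ => c) ∈ L
  coord : ∀ i : ℕ, (fun x => x i) ∈ L
  subst : ∀ {g : Fn} {σ : ℕ → Fn}, g ∈ L → (∀ i, σ i ∈ L) → (fun x => g fun i => σ i x) ∈ L

namespace Closed

variable {L : AddSubgroup Fn}

theorem smul_mem (c : ZMod 8) {g : Fn} (hg : g ∈ L) : c • g ∈ L := by
  have h : c • g = c.val • g := by
    funext x
    simp
  rw [h]
  exact L.nsmul_mem hg _

theorem update_mem (hL : Closed L) (i : ℕ) {g h : Fn} (hg : g ∈ L) (hh : h ∈ L) :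
    (fun x => g (Function.update x i (h x))) ∈ L := by
  have := hL.subst (σ := Function.update (fun j x => x j) i h) hg fun j => by
    by_cases hj : j = i
    · subst hj; simpa using hh
    · simpa [hj] using hL.coord j
  convert this using 3 with x
  funext j
  by_cases hj : j = i
  · subst hj; simp
  · simp [hj]

end Closed

theorem exists_lift_eq {K : Clone (ZMod 8)} {n N : ℕ} {f : Op (ZMod 8) n} (hf : f ∈ K.ops n)
    (h : n ≤ N) : ∃ f' ∈ K.ops N, lift f' = lift f :=
  ⟨fun x => f fun i => x (Fin.castLE h i), K.comp_mem hf fun _ => K.proj_mem N _, rfl⟩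

theorem add_mem_ops {K : Clone (ZMod 8)} (hK : groupPolynomials ≤ K) {n : ℕ}
    {f g : Op (ZMod 8) n} (hf : f ∈ K.ops n) (hg : g ∈ K.ops n) : f + g ∈ K.ops n := by
  have h2 : (fun x => x 0 + x 1 : Op (ZMod 8) 2) ∈ K.ops 2 :=
    hK 2 ⟨by norm_num, 0, fun _ => 1, fun x => by simp⟩
  exact K.comp_mem (g := ![f, g]) h2 fun i => by fin_cases i <;> assumption

/-- The functions given by the members of a clone that contains `P(ℤ₈, +)`. -/
def infinitary (K : Clone (ZMod 8)) (hK : groupPolynomials ≤ K) : AddSubgroup Fn where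
  carrier := {g | ∃ n, ∃ f ∈ K.ops n, g = lift f}
  zero_mem' := ⟨1, fun _ => 0, hK 1 ⟨one_pos, 0, 0, fun x => by simp⟩, rfl⟩
  add_mem' := by
    rintro _ _ ⟨n, f, hf, rfl⟩ ⟨m, g, hg, rfl⟩
    obtain ⟨f', hf', h1⟩ := exists_lift_eq hf (le_max_left n m)
    obtain ⟨g', hg', h2⟩ := exists_lift_eq hg (le_max_right n m)
    exact ⟨_, _, add_mem_ops hK hf' hg', by rw [← h1, ← h2]; rfl⟩
  neg_mem' := by
    rintro _ ⟨n, f, hf, rfl⟩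
    have h1 : (fun x => -x 0 : Op (ZMod 8) 1) ∈ K.ops 1 :=
      hK 1 ⟨by norm_num, 0, fun _ => -1, fun x => by simp⟩
    exact ⟨n, -f, K.comp_mem (g := fun _ => f) h1 fun _ => hf, rfl⟩

theorem lift_mem_infinitary {K : Clone (ZMod 8)} (hK : groupPolynomials ≤ K) {n : ℕ}
    {f : Op (ZMod 8) n} (hf : f ∈ K.ops n) : lift f ∈ infinitary K hK := ⟨n, f, hf, rfl⟩

theorem closed_infinitary {K : Clone (ZMod 8)} (hK : groupPolynomials ≤ K) :
    Closed (infinitary K hK) where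
  const c := ⟨1, fun _ => c, hK 1 ⟨one_pos, c, 0, fun x => by simp⟩, rfl⟩
  coord i := ⟨i + 1, fun x => x (Fin.last i), K.proj_mem _ _, rfl⟩
  subst := by
    rintro _ σ ⟨n, f, hf, rfl⟩ hσ
    choose m h hh hs using hσ
    -- Only the first `n` substituted functions matter, so they can be padded to a common arity.
    have hle : ∀ i : Fin n, m i ≤ (Finset.range n).sup m := fun i =>
      Finset.le_sup (Finset.mem_range.2 i.2)
    choose h' hh' hs' using fun i : Fin n => exists_lift_eq (hh i) (hle i)
    refine ⟨_, _, K.comp_mem hf hh', ?_⟩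
    funext x
    have : ∀ i : Fin n, σ i x = lift (h' i) x := fun i => by rw [hs', hs]
    simp only [lift, this]

theorem lift_mem_infinitary_iff {K : Clone (ZMod 8)} (hK : groupPolynomials ≤ K) {n : ℕ}
    (hn : 0 < n) {f : Op (ZMod 8) n} : lift f ∈ infinitary K hK ↔ f ∈ K.ops n := by
  refine ⟨?_, lift_mem_infinitary hK⟩
  rintro ⟨m, g, hg, hfg⟩
  have hz : (fun _ => 0 : Op (ZMod 8) n) ∈ K.ops n := hK n ⟨hn, 0, 0, fun x => by simp⟩
  -- The surplus variables of `g` are replaced by the constant 0, which is available in positive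
  -- arity.
  have h := K.comp_mem (g := fun (i : Fin m) (x : Fin n → ZMod 8) =>
    if h : (i : ℕ) < n then x ⟨i, h⟩ else 0) hg fun i => by
      by_cases hi : (i : ℕ) < n
      · simpa [hi] using K.proj_mem n ⟨i, hi⟩
      · simpa [hi] using hz
  convert h using 1
  funext x
  have := congrFun hfg fun i => if h : i < n then x ⟨i, h⟩ else 0
  simpa [lift] using this

/-! ### Binary digits and pure functions -/

/-- The last binary digit. -/
def bit₀ (x : ZMod 8) : ZMod 8 := (x.val % 2 : ℕ)

/-- The last but one binary digit. -/
def bit₁ (x : ZMod 8) : ZMod 8 := (x.val / 2 % 2 : ℕ)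

/-- The function that is `1` where all variables with index in `A` are odd and `0` elsewhere. -/
def oddProd (A : Finset ℕ) : Fn := fun x => ∏ i ∈ A, bit₀ (x i)

/-- The functions that take even values, vanish where some variable with index in `A` does, and
depend only on these variables, in the normal form with respect to the binary digits. -/
def pureFn (A : Finset ℕ) (c : ZMod 8) (α β : ℕ → ZMod 8) : Fn := fun x =>
  2 * c * oddProd A x + 4 * ∑ i ∈ A, bit₁ (x i) * (α i + β i * bit₀ (x i)) * oddProd (A.erase i) x

variable {A B : Finset ℕ} {c c' : ZMod 8} {α β α' β' : ℕ → ZMod 8} {x y : ℕ → ZMod 8} {i j : ℕ}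

theorem bit₀_zero : bit₀ 0 = 0 := by decide

theorem bit₁_zero : bit₁ 0 = 0 := by decide

theorem bit₀_mul_self (a : ZMod 8) : bit₀ a * bit₀ a = bit₀ a := by revert a; decide

theorem oddProd_insert (hi : i ∉ B) (x : ℕ → ZMod 8) :
    oddProd (insert i B) x = bit₀ (x i) * oddProd B x := Finset.prod_insert hi

theorem oddProd_congr (h : ∀ i ∈ A, x i = y i) : oddProd A x = oddProd A y :=
  Finset.prod_congr rfl fun i hi => by rw [h i hi]

theorem bit₀_mul_oddProd (hi : i ∈ A) (x : ℕ → ZMod 8) :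
    bit₀ (x i) * oddProd A x = oddProd A x := by
  rw [← Finset.insert_erase hi, oddProd_insert (Finset.notMem_erase _ _), ← mul_assoc,
    bit₀_mul_self]

theorem pureFn_congr_vars (h : ∀ i ∈ A, x i = y i) : pureFn A c α β x = pureFn A c α β y := by
  unfold pureFn
  rw [oddProd_congr h]
  congr 2
  exact Finset.sum_congr rfl fun i hi => by
    rw [h i hi, oddProd_congr fun j hj => h j (Finset.mem_of_mem_erase hj)]

theorem pureFn_update (hi : i ∉ A) (a : ZMod 8) :
    pureFn A c α β (Function.update x i a) = pureFn A c α β x :=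
  pureFn_congr_vars fun j hj => Function.update_of_ne (fun h : j = i => hi (h ▸ hj)) _ _

theorem oddProd_update (hi : i ∉ A) (a : ZMod 8) :
    oddProd A (Function.update x i a) = oddProd A x :=
  oddProd_congr fun j hj => Function.update_of_ne (fun h : j = i => hi (h ▸ hj)) _ _

theorem pureFn_insert (hi : i ∉ B) (c : ZMod 8) (α β : ℕ → ZMod 8) (x : ℕ → ZMod 8) :
    pureFn (insert i B) c α β x = bit₀ (x i) * pureFn B c α β x +
      4 * (bit₁ (x i) * (α i + β i * bit₀ (x i))) * oddProd B x := by
  unfold pureFn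
  rw [Finset.sum_insert hi, Finset.erase_insert hi, oddProd_insert hi]
  have h : ∑ j ∈ B, bit₁ (x j) * (α j + β j * bit₀ (x j)) * oddProd ((insert i B).erase j) x =
      bit₀ (x i) * ∑ j ∈ B, bit₁ (x j) * (α j + β j * bit₀ (x j)) * oddProd (B.erase j) x := by
    rw [Finset.mul_sum]
    refine Finset.sum_congr rfl fun j hj => ?_
    rw [Finset.erase_insert_of_ne fun h : i = j => hi (h ▸ hj),
      oddProd_insert fun h => hi (Finset.mem_of_mem_erase h)]
    ring
  rw [h]
  ring

theorem pureFn_empty (c : ZMod 8) (α β : ℕ → ZMod 8) : pureFn ∅ c α β = fun _ => 2 * c := by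
  funext x
  simp [pureFn, oddProd]

theorem two_mul_pureFn (A : Finset ℕ) (c : ZMod 8) (α β : ℕ → ZMod 8) (x : ℕ → ZMod 8) :
    2 * pureFn A c α β x = 4 * c * oddProd A x := by
  have h8 : (8 : ZMod 8) = 0 := by decide
  unfold pureFn
  linear_combination
    (∑ i ∈ A, bit₁ (x i) * (α i + β i * bit₀ (x i)) * oddProd (A.erase i) x) * h8

theorem pureFn_congr (hc : 2 * c = 2 * c') (hα : ∀ i ∈ A, 4 * α i = 4 * α' i)
    (hβ : ∀ i ∈ A, 4 * β i = 4 * β' i) : pureFn A c α β = pureFn A c' α' β' := by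
  funext x
  unfold pureFn
  rw [hc, Finset.mul_sum, Finset.mul_sum]
  congr 1
  refine Finset.sum_congr rfl fun i hi => ?_
  linear_combination (bit₁ (x i) * oddProd (A.erase i) x) * hα i hi +
    (bit₁ (x i) * bit₀ (x i) * oddProd (A.erase i) x) * hβ i hi

theorem pureFn_add : pureFn A c α β + pureFn A c' α' β' = pureFn A (c + c') (α + α') (β + β') := by
  funext x
  simp only [pureFn, Pi.add_apply]
  rw [show ∑ i ∈ A, bit₁ (x i) * (α i + α' i + (β i + β' i) * bit₀ (x i)) * oddProd (A.erase i) x =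
    ∑ i ∈ A, bit₁ (x i) * (α i + β i * bit₀ (x i)) * oddProd (A.erase i) x +
    ∑ i ∈ A, bit₁ (x i) * (α' i + β' i * bit₀ (x i)) * oddProd (A.erase i) x by
      rw [← Finset.sum_add_distrib]; exact Finset.sum_congr rfl fun i _ => by ring]
  ring

theorem pureFn_smul (d : ZMod 8) : d • pureFn A c α β = pureFn A (d * c) (d • α) (d • β) := by
  funext x
  simp only [pureFn, Pi.smul_apply, smul_eq_mul]
  rw [show ∑ i ∈ A, bit₁ (x i) * (d * α i + d * β i * bit₀ (x i)) * oddProd (A.erase i) x =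
    d * ∑ i ∈ A, bit₁ (x i) * (α i + β i * bit₀ (x i)) * oddProd (A.erase i) x by
      rw [Finset.mul_sum]; exact Finset.sum_congr rfl fun i _ => by ring]
  ring

theorem pureFn_sum {ι : Type*} (S : Finset ι) (c : ι → ZMod 8) (α β : ι → ℕ → ZMod 8) :
    ∑ k ∈ S, pureFn A (c k) (α k) (β k) = pureFn A (∑ k ∈ S, c k) (∑ k ∈ S, α k) (∑ k ∈ S, β k) := by
  classical
  induction S using Finset.induction_on with
  | empty => funext x; simp [pureFn]
  | insert k S hk ih => simp only [Finset.sum_insert hk, ih, pureFn_add]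

/-- Renaming of variables. -/
theorem pureFn_comp {σ τ : ℕ → ℕ} (h : ∀ i ∈ A, τ (σ i) = i) (x : ℕ → ZMod 8) :
    pureFn A c α β (x ∘ σ) = pureFn (A.image σ) c (α ∘ τ) (β ∘ τ) x := by
  have hinj : Set.InjOn σ A := fun i hi j hj hij => by rw [← h i hi, hij, h j hj]
  have hp : ∀ B ⊆ A, oddProd B (x ∘ σ) = oddProd (B.image σ) x := fun B hB =>
    (Finset.prod_image (f := fun i => bit₀ (x i)) (hinj.mono (by exact_mod_cast hB))).symm
  unfold pureFn
  rw [hp A subset_rfl, Finset.sum_image hinj]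
  congr 2
  refine Finset.sum_congr rfl fun i hi => ?_
  rw [hp _ (Finset.erase_subset _ _), Function.comp_apply, Function.comp_apply,
    Function.comp_apply, h i hi]
  congr 2
  ext k
  simp only [Finset.mem_image, Finset.mem_erase]
  constructor
  · rintro ⟨j, ⟨hji, hj⟩, rfl⟩
    exact ⟨fun h' => hji (hinj hj hi h'), j, hj, rfl⟩
  · rintro ⟨hk, j, hj, rfl⟩
    exact ⟨j, ⟨fun h' => hk (h' ▸ rfl), hj⟩, rfl⟩

/-! ### Decomposition into pure functions -/

theorem pureFn_eq_zero (hj : j ∈ A) (hx : x j = 0) : pureFn A c α β x = 0 := by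
  rw [← Finset.insert_erase hj, pureFn_insert (Finset.notMem_erase _ _), hx, bit₀_zero, bit₁_zero]
  ring

/-- For an inclusion-minimal `B`, setting all variables outside `B` to 0 kills every other summand.
The summand of `B` is then subtracted and the argument repeated. -/
theorem Closed.pureFn_mem_of_sum_mem {L : AddSubgroup Fn} (hL : Closed L)
    (c : Finset ℕ → ZMod 8) (α β : Finset ℕ → ℕ → ZMod 8) (S : Finset (Finset ℕ))
    (h : ∑ A ∈ S, pureFn A (c A) (α A) (β A) ∈ L) :
    ∀ A ∈ S, pureFn A (c A) (α A) (β A) ∈ L := by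
  induction S using Finset.strongInduction with
  | H S ih =>
    intro A hA
    obtain ⟨B, hB, hmin⟩ := S.exists_minimal ⟨A, hA⟩
    have hBL : pureFn B (c B) (α B) (β B) ∈ L := by
      have h1 := hL.subst (σ := fun i x => if i ∈ B then x i else 0) h fun i => by
        by_cases hi : i ∈ B
        · simpa [hi] using hL.coord i
        · simpa [hi] using hL.const 0
      convert h1 using 1
      funext x
      rw [Finset.sum_apply, Finset.sum_eq_single B]
      · exact pureFn_congr_vars fun i hi => by simp [hi]
      · intro D hD hDB
        have hsub : ¬D ⊆ B := fun hs => hDB (subset_antisymm hs (hmin hD hs))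
        obtain ⟨j, hj, hjB⟩ := Finset.not_subset.1 hsub
        exact pureFn_eq_zero hj (by simp [hjB])
      · exact fun hB' => absurd hB hB'
    by_cases hAB : A = B
    · rwa [hAB]
    · refine ih (S.erase B) (Finset.erase_ssubset hB) ?_ A (Finset.mem_erase.2 ⟨hAB, hA⟩)
      rw [← Finset.add_sum_erase S _ hB] at h
      exact (L.add_mem_cancel_left hBL).1 h

end CloneZ8

/-! ### Substitutions in pure functions -/

namespace CloneZ8

variable {A B : Finset ℕ} {c c' : ZMod 8} {α β α' β' : ℕ → ZMod 8} {x y : ℕ → ZMod 8} {i j k : ℕ}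
  {L M : AddSubgroup Fn} {n : ℕ}

theorem pureFn_zero_zero (A : Finset ℕ) (c : ZMod 8) (x : ℕ → ZMod 8) :
    pureFn A c 0 0 x = 2 * c * oddProd A x := by
  simp [pureFn]

theorem pureFn_single_zero (hi : i ∈ A) (a : ZMod 8) (x : ℕ → ZMod 8) :
    pureFn A 0 (Pi.single i a) 0 x = 4 * a * bit₁ (x i) * oddProd (A.erase i) x := by
  unfold pureFn
  rw [Finset.sum_eq_single_of_mem i hi fun j _ hj => by simp [hj]]
  simp
  ring

theorem pureFn_zero_single (hi : i ∈ A) (a : ZMod 8) (x : ℕ → ZMod 8) :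
    pureFn A 0 0 (Pi.single i a) x = 4 * a * bit₁ (x i) * oddProd A x := by
  rw [← bit₀_mul_oddProd hi]
  nth_rw 2 [← Finset.insert_erase hi]
  rw [oddProd_insert (Finset.notMem_erase _ _)]
  unfold pureFn
  rw [Finset.sum_eq_single_of_mem i hi fun j _ hj => by simp [hj]]
  simp
  linear_combination (- 4 * a * bit₁ (x i) * oddProd (A.erase i) x) * bit₀_mul_self (x i)

/-- Parity in `ℤ₈` is expressed throughout by `4 * a`: it is 0 for even `a` and 4 for odd `a`. -/
theorem four_mul_eq (a : ZMod 8) : 4 * a = 0 ∨ 4 * a = 4 := by revert a; decide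

theorem eight_eq_zero : (8 : ZMod 8) = 0 := by decide

namespace Closed

/-- Linear combinations of pure functions, with the parameters up to the relevant moduli. -/
theorem combine (d d' : ZMod 8) {c'' : ZMod 8} {α'' β'' : ℕ → ZMod 8}
    (h : pureFn A c α β ∈ L) (h' : pureFn A c' α' β' ∈ L)
    (hc : 2 * c'' = 2 * (d * c + d' * c')) (hα : ∀ i ∈ A, 4 * α'' i = 4 * (d * α i + d' * α' i))
    (hβ : ∀ i ∈ A, 4 * β'' i = 4 * (d * β i + d' * β' i)) : pureFn A c'' α'' β'' ∈ L := by
  have := L.add_mem (smul_mem d h) (smul_mem d' h')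
  rw [pureFn_smul, pureFn_smul, pureFn_add] at this
  rwa [pureFn_congr hc hα hβ]

theorem rename {σ τ : ℕ → ℕ} (hL : Closed L) (hστ : ∀ i ∈ A, τ (σ i) = i) (hB : A.image σ = B)
    (h : pureFn A c α β ∈ L) : pureFn B c (α ∘ τ) (β ∘ τ) ∈ L := by
  have := hL.subst (σ := fun i x => x (σ i)) h fun i => hL.coord _
  convert this using 1
  funext x
  rw [← hB, ← pureFn_comp hστ]
  rfl

theorem swap_mem (hL : Closed L) (hi : i ∈ A) (hj : j ∈ A) (h : pureFn A c α β ∈ L) :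
    pureFn A c (α ∘ Equiv.swap i j) (β ∘ Equiv.swap i j) ∈ L := by
  refine hL.rename (σ := Equiv.swap i j) (fun k _ => Equiv.swap_apply_self i j k) ?_ h
  refine Finset.eq_of_subset_of_card_le ?_
    (Finset.card_image_of_injective _ (Equiv.swap i j).injective).ge
  intro k hk
  obtain ⟨l, hl, rfl⟩ := Finset.mem_image.1 hk
  rcases eq_or_ne l i with rfl | h1
  · simpa using hj
  rcases eq_or_ne l j with rfl | h2
  · simpa using hi
  rwa [Equiv.swap_apply_of_ne_of_ne h1 h2]

/-- The effect of the substitution `-x i` for `x i`. -/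
theorem neg_var_mem (hL : Closed L) (hi : i ∈ A) (h : pureFn A c α β ∈ L) :
    pureFn A (2 * (α i + β i)) 0 0 ∈ L := by
  have h1 := L.sub_mem (hL.update_mem i h (L.neg_mem (hL.coord i))) h
  convert h1 using 1
  funext x
  obtain ⟨B, hB, rfl⟩ : ∃ B, i ∉ B ∧ A = insert i B :=
    ⟨A.erase i, Finset.notMem_erase _ _, (Finset.insert_erase hi).symm⟩
  have d1 : ∀ a : ZMod 8, bit₀ (-a) = bit₀ a := by decide
  -- Negation keeps the last digit and adds it to the next one modulo 2.
  have d2 : ∀ a : ZMod 8, 4 * bit₁ (-a) = 4 * bit₁ a + 4 * bit₀ a := by decide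
  rw [Pi.sub_apply, pureFn_insert hB, pureFn_insert hB, pureFn_insert hB, pureFn_update hB,
    oddProd_update hB, pureFn_zero_zero]
  simp only [Function.update_self, Pi.neg_apply, d1, Pi.zero_apply]
  linear_combination (-(α i + β i * bit₀ (x i)) * oddProd B x) * d2 (x i) -
    4 * β i * oddProd B x * bit₀_mul_self (x i)

/-- The effect of the substitution `x i + 1` for `x i`. -/
theorem add_one_var_mem (hL : Closed L) (hi : i ∈ A) (h : pureFn A c α β ∈ L) :
    pureFn A (2 * (α i - c)) (Pi.single i (β i)) 0 ∈ L := by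
  -- The combination is `f(xᵢ + 1) - f(1) - f(xᵢ)`; subtracting the value at 1 as well removes the
  -- part that does not involve `x i`.
  have h1 := L.sub_mem (L.sub_mem (hL.update_mem i h (L.add_mem (hL.coord i) (hL.const 1)))
    (hL.update_mem i h (hL.const 1))) h
  convert h1 using 1
  funext x
  obtain ⟨B, hB, rfl⟩ : ∃ B, i ∉ B ∧ A = insert i B :=
    ⟨A.erase i, Finset.notMem_erase _ _, (Finset.insert_erase hi).symm⟩
  have d1 : ∀ a : ZMod 8, bit₀ (a + 1) = 1 - bit₀ a := by decide
  have d2 : ∀ a : ZMod 8, 4 * bit₁ (a + 1) = 4 * bit₁ a + 4 * bit₀ a := by decide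
  have e1 : bit₀ 1 = 1 := by decide
  have e2 : bit₁ 1 = 0 := by decide
  have e3 : pureFn B (2 * (α i - c)) (Pi.single i (β i)) 0 x = 4 * (α i - c) * oddProd B x := by
    rw [pureFn_congr (α' := 0) (β' := 0) (c' := 2 * (α i - c)) rfl (fun j hj => by
      rw [Pi.single_eq_of_ne fun h : j = i => hB (h ▸ hj)]; rfl) fun _ _ => rfl, pureFn_zero_zero]
    ring
  rw [Pi.sub_apply, Pi.sub_apply, pureFn_insert hB, pureFn_insert hB, pureFn_insert hB,
    pureFn_insert hB, pureFn_update hB, oddProd_update hB, pureFn_update hB, oddProd_update hB, e3]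
  simp only [Function.update_self, Pi.add_apply, d1, Pi.zero_apply, Pi.single_eq_same, e1, e2]
  have e4 := two_mul_pureFn B c α β x
  linear_combination (bit₀ (x i)) * e4 -
    ((α i + β i - β i * bit₀ (x i)) * oddProd B x) * d2 (x i) +
    4 * β i * oddProd B x * bit₀_mul_self (x i) +
    (β i * bit₁ (x i) * bit₀ (x i) * oddProd B x) * eight_eq_zero

/-- The effect of the substitution `x i + x j` for `x j`. -/
theorem add_var_mem (hL : Closed L) (hij : i ≠ j) (hi : i ∈ A) (hj : j ∈ A)
    (h : pureFn A c 0 β ∈ L) :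
    pureFn A (-2 * c) (Pi.single j (β j)) (Pi.single i (β j)) ∈ L := by
  have h1 := L.sub_mem (L.sub_mem (hL.update_mem j h (L.add_mem (hL.coord i) (hL.coord j)))
    (hL.update_mem j h (hL.coord i))) h
  convert h1 using 1
  funext x
  obtain ⟨D, hD, rfl⟩ : ∃ B, j ∉ B ∧ A = insert j B :=
    ⟨A.erase j, Finset.notMem_erase _ _, (Finset.insert_erase hj).symm⟩
  have hi' : i ∈ D := (Finset.mem_insert.1 hi).resolve_left hij
  obtain ⟨B, hB, rfl⟩ : ∃ B, i ∉ B ∧ D = insert i B :=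
    ⟨D.erase i, Finset.notMem_erase _ _, (Finset.insert_erase hi').symm⟩
  have hjB : j ∉ B := fun h => hD (Finset.mem_insert_of_mem h)
  have d1 : ∀ a b : ZMod 8, bit₀ (a + b) * bit₀ a - bit₀ a * bit₀ a - bit₀ b * bit₀ a =
    -2 * (bit₀ a * bit₀ b) := by decide
  have d2 : ∀ a b : ZMod 8, 4 * (bit₁ (a + b) * bit₀ (a + b) * bit₀ a - bit₁ a * bit₀ a * bit₀ a -
      bit₁ b * bit₀ b * bit₀ a) = 4 * (bit₁ b * bit₀ a + bit₀ b * bit₁ a * bit₀ a) := by decide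
  have e3 : pureFn B (-2 * c) (Pi.single j (β j)) (Pi.single i (β j)) x =
      -4 * c * oddProd B x := by
    rw [pureFn_congr (α' := 0) (β' := 0) (c' := -2 * c) rfl (fun k hk => by
      rw [Pi.single_eq_of_ne fun h : k = j => hjB (h ▸ hk)]; rfl) fun k hk => by
      rw [Pi.single_eq_of_ne fun h : k = i => hB (h ▸ hk)]; rfl, pureFn_zero_zero]
    ring
  rw [Pi.sub_apply, Pi.sub_apply, pureFn_insert hD, pureFn_insert hD, pureFn_insert hD,
    pureFn_insert hD, pureFn_update hD, oddProd_update hD, pureFn_update hD, oddProd_update hD,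
    pureFn_insert hB, pureFn_insert hB, e3, oddProd_insert hB]
  simp only [Function.update_self, Pi.add_apply, Pi.zero_apply, Pi.single_eq_same,
    Pi.single_eq_of_ne hij, Pi.single_eq_of_ne hij.symm]
  have e4 := two_mul_pureFn B c 0 β x
  linear_combination (bit₀ (x i) * bit₀ (x j)) * e4 -
    (pureFn B c 0 β x + 4 * bit₁ (x i) * β i * oddProd B x) * d1 (x i) (x j) -
    (β j * oddProd B x) * d2 (x i) (x j) +
    (bit₁ (x i) * β i * oddProd B x * bit₀ (x i) * bit₀ (x j)) * eight_eq_zero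

/-- The effect of the substitution `x i + x k` for `x i`, where `x k` is a new variable. -/
theorem add_new_var_mem (hL : Closed L) (hi : i ∈ A) (hk : k ∉ A)
    (h : pureFn A 0 0 (Pi.single i 1) ∈ L) :
    pureFn (insert k A) 0 (Pi.single i 1 + Pi.single k 1) 0 ∈ L := by
  have h1 := L.sub_mem (L.sub_mem (hL.update_mem i h (L.add_mem (hL.coord i) (hL.coord k)))
    (hL.update_mem i h (hL.coord k))) h
  convert h1 using 1
  funext x
  have hik : i ≠ k := fun h => hk (h ▸ hi)
  obtain ⟨B, hB, rfl⟩ : ∃ B, i ∉ B ∧ A = insert i B :=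
    ⟨A.erase i, Finset.notMem_erase _ _, (Finset.insert_erase hi).symm⟩
  -- Modulo 2, the product of the two digits polarises to a bilinear expression in the digits of `a`
  -- and `b`; this produces the coefficients at `i` and `k`.
  have d : ∀ a b : ZMod 8, 4 * (bit₁ (a + b) * bit₀ (a + b) - bit₁ b * bit₀ b - bit₁ a * bit₀ a) =
      4 * (bit₁ a * bit₀ b + bit₁ b * bit₀ a) := by decide
  have e : ∀ y, pureFn B 0 0 (Pi.single i 1) y = 0 := fun y => by
    rw [pureFn_congr (α' := 0) (β' := 0) (c' := 0) rfl (fun k hk => rfl) fun k hk => by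
      rw [Pi.single_eq_of_ne fun h : k = i => hB (h ▸ hk)]; rfl, pureFn_zero_zero]
    ring
  have e' : pureFn B 0 (Pi.single i 1 + Pi.single k 1) 0 x = 0 := by
    rw [pureFn_congr (α' := 0) (β' := 0) (c' := 0) rfl (fun l hl => by
      rw [Pi.add_apply, Pi.single_eq_of_ne fun h : l = i => hB (h ▸ hl),
        Pi.single_eq_of_ne fun h : l = k => hk (h ▸ Finset.mem_insert_of_mem hl)]
      simp) fun k hk => rfl, pureFn_zero_zero]
    ring
  rw [Pi.sub_apply, Pi.sub_apply, pureFn_insert hk, pureFn_insert hB, pureFn_insert hB,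
    pureFn_insert hB, pureFn_insert hB, oddProd_update hB, oddProd_update hB, e, e, e, e',
    oddProd_insert hB]
  simp only [Function.update_self, Pi.add_apply, Pi.zero_apply, Pi.single_eq_same,
    Pi.single_eq_of_ne hik, Pi.single_eq_of_ne hik.symm]
  linear_combination -oddProd B x * d (x i) (x k)

/-- The effect of the substitution `x i` for a variable `x k`. -/
theorem identify_var_mem (hL : Closed L) (hij : i ≠ j) (hi : i ∈ A) (hj : j ∈ A) (hk : k ∉ A)
    (h : pureFn (insert k A) 0 (Pi.single i 1 + Pi.single j 1) 0 ∈ L) :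
    pureFn A 0 (Pi.single j 1) (Pi.single i 1) ∈ L := by
  have h1 := hL.update_mem k h (hL.coord i)
  convert h1 using 1
  funext x
  have hik : k ≠ i := fun h => hk (h ▸ hi)
  have hjk : k ≠ j := fun h => hk (h ▸ hj)
  rw [pureFn_insert hk, pureFn_update hk, oddProd_update hk]
  simp only [Function.update_self, Pi.add_apply, Pi.zero_apply,
    Pi.single_eq_of_ne hik, Pi.single_eq_of_ne hjk]
  have e1 : pureFn A 0 (Pi.single j 1) (Pi.single i 1) x =
      pureFn A 0 (Pi.single j 1) 0 x + pureFn A 0 0 (Pi.single i 1) x := by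
    rw [← Pi.add_apply (pureFn _ _ _ _), pureFn_add]
    simp
  have e2 : pureFn A 0 (Pi.single i 1 + Pi.single j 1) 0 x =
      pureFn A 0 (Pi.single i 1) 0 x + pureFn A 0 (Pi.single j 1) 0 x := by
    rw [← Pi.add_apply (pureFn _ _ _ _), pureFn_add]
    simp
  have e3 := bit₀_mul_oddProd (Finset.mem_erase.2 ⟨hij, hi⟩) x
  have e4 : bit₀ (x i) * oddProd (A.erase i) x = oddProd A x := by
    rw [← oddProd_insert (Finset.notMem_erase _ _), Finset.insert_erase hi]
  rw [e1, e2, pureFn_single_zero hi, pureFn_single_zero hj, pureFn_zero_single hi]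
  linear_combination -4 * bit₁ (x j) * e3 - 4 * bit₁ (x i) * e4

end Closed

end CloneZ8

namespace CloneZ8

open Finset (range mem_range)

variable {A B : Finset ℕ} {c c' : ZMod 8} {α β α' β' : ℕ → ZMod 8} {i j k : ℕ}
  {L M : AddSubgroup Fn} {n : ℕ}

/-! ### The families of generators in normal form -/

/-- The coefficient of the product of the last digits in `2 tₙ`. -/
def tCoeff (n : ℕ) : ZMod 8 := if Even n then n else n + 1

/-- The coefficient of the product of the last digits in `2 sₙ`. -/
def sCoeff (n : ℕ) : ZMod 8 := if Odd n then n else n + 1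

theorem four_mul_cast_even (h : Even n) : 4 * (n : ZMod 8) = 0 := by
  obtain ⟨k, rfl⟩ := h
  push_cast
  linear_combination k * eight_eq_zero

theorem four_mul_cast_odd (h : Odd n) : 4 * (n : ZMod 8) = 4 := by
  obtain ⟨k, rfl⟩ := h
  push_cast
  linear_combination k * eight_eq_zero

theorem four_mul_tCoeff (n : ℕ) : 4 * tCoeff n = 0 := by
  unfold tCoeff
  split_ifs with h
  · exact four_mul_cast_even h
  · rw [mul_add, four_mul_cast_odd (Nat.not_even_iff_odd.1 h)]
    decide

theorem four_mul_sCoeff (n : ℕ) : 4 * sCoeff n = 4 := by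
  unfold sCoeff
  split_ifs with h
  · exact four_mul_cast_odd h
  · rw [mul_add, four_mul_cast_even (Nat.not_odd_iff_even.1 h)]
    decide

/-- The function of `2 tₙ`. -/
def tFn (n : ℕ) : Fn := pureFn (range n) (tCoeff n) 1 0

/-- The function of `2 uₙ`. -/
def uFn (n : ℕ) : Fn := pureFn (range n) 2 (Pi.single 0 1) 0

/-- The function of `2 vₙ`. -/
def vFn (n : ℕ) : Fn := pureFn (range n) 2 (Pi.single 0 1 + Pi.single 1 1) 0

/-- The function of `2 sₙ`. -/
def sFn (n : ℕ) : Fn := pureFn (range n) (sCoeff n) 0 0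

/-- The function of `2 pₙ`. -/
def pFn (n : ℕ) : Fn := pureFn (range n) 1 (1 + Pi.single 0 1) 0

/-- The function of `2 qₙ`. -/
def qFn (n : ℕ) : Fn := pureFn (range n) 1 (1 + Pi.single 0 1) (Pi.single 0 1)

/-- The function of `2 rₙ`. -/
def rFn (n : ℕ) : Fn := pureFn (range n) 1 1 0

/-- The function of `4 rₙ`. -/
def eFn (n : ℕ) : Fn := pureFn (range n) 2 0 0

/-- All generators that belong to `L` belong to `M`. -/
structure Transfer (L M : AddSubgroup Fn) : Prop where
  t : ∀ n, 1 ≤ n → tFn n ∈ L → tFn n ∈ M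
  u : ∀ n, 1 ≤ n → uFn n ∈ L → uFn n ∈ M
  v : ∀ n, 2 ≤ n → vFn n ∈ L → vFn n ∈ M
  s : ∀ n, 1 ≤ n → sFn n ∈ L → sFn n ∈ M
  p : ∀ n, 1 ≤ n → pFn n ∈ L → pFn n ∈ M
  q : ∀ n, 1 ≤ n → qFn n ∈ L → qFn n ∈ M
  r : ∀ n, 1 ≤ n → rFn n ∈ L → rFn n ∈ M
  e : ∀ n, 1 ≤ n → eFn n ∈ L → eFn n ∈ M

theorem exists_eq_two_mul (h : 4 * c = 0) : ∃ d, c = 2 * d := by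
  revert c; decide

theorem mul_self_of_odd (h : 4 * c = 4) : c * c = 1 := by
  revert c; decide

theorem single_comp_swap (i j k : ℕ) (a : ZMod 8) :
    (Pi.single k a : ℕ → ZMod 8) ∘ Equiv.swap i j = Pi.single (Equiv.swap i j k) a := by
  funext l
  simp [Pi.single_apply, Equiv.swap_apply_eq_iff]

namespace Closed

theorem pureFn_of_singles (h : ∀ i ∈ A, pureFn A 0 (Pi.single i 1) 0 ∈ L) (α : ℕ → ZMod 8) :
    pureFn A 0 α 0 ∈ L := by
  have h1 := L.sum_mem fun i hi => smul_mem (α i) (h i hi)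
  simp only [pureFn_smul] at h1
  rw [pureFn_sum] at h1
  convert h1 using 1
  refine pureFn_congr (by simp) (fun i hi => ?_) fun i _ => ?_
  · simp [Finset.sum_apply, Pi.single_apply, hi]
  · simp

theorem pureFn_of_singles_right (h : ∀ i ∈ A, pureFn A 0 0 (Pi.single i 1) ∈ L) (β : ℕ → ZMod 8) :
    pureFn A 0 0 β ∈ L := by
  have h1 := L.sum_mem fun i hi => smul_mem (β i) (h i hi)
  simp only [pureFn_smul] at h1
  rw [pureFn_sum] at h1
  convert h1 using 1
  refine pureFn_congr (by simp) (fun i _ => ?_) fun i hi => ?_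
  · simp
  · simp [Finset.sum_apply, Pi.single_apply, hi]

theorem pureFn_of_single (hL : Closed L) (hi : i ∈ A) (h : pureFn A 0 (Pi.single i 1) 0 ∈ L)
    (α : ℕ → ZMod 8) : pureFn A 0 α 0 ∈ L := by
  refine pureFn_of_singles (fun j hj => ?_) α
  have := hL.swap_mem hi hj h
  rwa [single_comp_swap, Equiv.swap_apply_left] at this

theorem pureFn_of_single_right (hL : Closed L) (hi : i ∈ A)
    (h : pureFn A 0 0 (Pi.single i 1) ∈ L) (β : ℕ → ZMod 8) : pureFn A 0 0 β ∈ L := by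
  refine pureFn_of_singles_right (fun j hj => ?_) β
  have := hL.swap_mem hi hj h
  rwa [single_comp_swap, Equiv.swap_apply_left] at this

theorem pureFn_of_two (h : pureFn A 2 0 0 ∈ L) (hc : 4 * c = 0) : pureFn A c 0 0 ∈ L := by
  obtain ⟨d, rfl⟩ := exists_eq_two_mul hc
  exact combine d 0 h h (by ring) (by simp) (by simp)

/-- If a pure function has an odd coefficient `α i` and `β = 0`, then `4 ∏ xᵢ` is present. -/
theorem two_mem_of_odd (hL : Closed L) (hi : i ∈ A) (h : pureFn A c α 0 ∈ L) (hα : 4 * α i = 4) :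
    pureFn A 2 0 0 ∈ L := by
  have h1 := hL.neg_var_mem hi h
  rwa [pureFn_congr (c' := 2) (α' := 0) (β' := 0) (by rw [Pi.zero_apply]; linear_combination hα)
    (fun _ _ => rfl) fun _ _ => rfl] at h1

end Closed

/-! ### Pure functions with `β ≠ 0` -/

/-- `L` contains all pure functions of the first `n` variables with even `c`. -/
structure Full (L : AddSubgroup Fn) (n : ℕ) : Prop where
  two : pureFn (range n) 2 0 0 ∈ L
  left : ∀ α, pureFn (range n) 0 α 0 ∈ L
  right : ∀ β, pureFn (range n) 0 0 β ∈ L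

namespace Full

theorem mem_of_even (h : Full L n) (hc : 4 * c = 0) (α β : ℕ → ZMod 8) :
    pureFn (range n) c α β ∈ L := by
  have h1 := L.add_mem (L.add_mem (Closed.pureFn_of_two h.two hc) (h.left α)) (h.right β)
  rw [pureFn_add, pureFn_add] at h1
  simpa using h1

theorem one_mem (h : Full L n) (hc : 4 * c = 4) (hf : pureFn (range n) c α β ∈ L) :
    pureFn (range n) 1 0 0 ∈ L :=
  Closed.combine c (-c) hf (h.mem_of_even (c := 0) (by simp) α β)
    (by rw [mul_self_of_odd hc]; ring) (fun i _ => by simp) fun i _ => by simp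

theorem mem_of_one_mem (h : Full L n) (h1 : pureFn (range n) 1 0 0 ∈ L) (c : ZMod 8)
    (α β : ℕ → ZMod 8) : pureFn (range n) c α β ∈ L :=
  Closed.combine c 1 h1 (h.mem_of_even (c := 0) (by simp) α β) (by ring) (fun i _ => by simp)
    fun i _ => by simp

end Full

namespace Closed

/-- Special to one variable: `2 x` is always available and equals `2 bit₀ x + 4 bit₁ x`. -/
theorem one_mem_of_single (hL : Closed L) (h : pureFn (range 1) 0 (Pi.single 0 1) 0 ∈ L) :
    pureFn (range 1) 1 0 0 ∈ L := by
  have h1 := L.sub_mem (smul_mem 2 (hL.coord 0)) h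
  convert h1 using 1
  funext x
  have d : ∀ a : ZMod 8, 2 * bit₀ a = 2 * a - 4 * bit₁ a := by decide
  rw [pureFn_zero_zero, Pi.sub_apply, pureFn_single_zero (by simp)]
  simp [oddProd, d]

/-- The substitution `x j + 1` isolates the odd `β j` as a coefficient in `α`. Negation then gives
`4 ∏ xᵢ`, and permutations give every `α`. To isolate `β`, the leading coefficient must become
removable: for one variable by `one_mem_of_single`, otherwise by adding another variable, which
moves `β j` to that index and makes the leading coefficient even. -/
theorem full_of_odd (hL : Closed L) (hj : j ∈ range n) (hβ : 4 * β j = 4)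
    (h : pureFn (range n) c α β ∈ L) : Full L n := by
  have h1 := hL.add_one_var_mem hj h
  have h2 : pureFn (range n) 2 0 0 ∈ L := hL.two_mem_of_odd hj h1 (by simpa using hβ)
  have h3 : pureFn (range n) 0 (Pi.single j 1) 0 ∈ L := by
    refine combine 1 (-(α j - c)) h1 h2 (by ring) (fun i _ => ?_) (by simp)
    by_cases hij : i = j
    · subst hij; simp [hβ]
    · simp [hij]
  have hα := hL.pureFn_of_single hj h3
  have h4 : pureFn (range n) c 0 β ∈ L :=
    combine 1 (-1) h (hα α) (by ring) (fun i _ => by simp) fun i _ => by simp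
  refine ⟨h2, hα, ?_⟩
  by_cases hn : n = 1
  · subst hn
    obtain rfl : j = 0 := by simpa using hj
    have h5 := hL.one_mem_of_single h3
    refine hL.pureFn_of_single_right hj (combine 1 (-c) h4 h5 (by ring) (by simp) fun i hi => ?_)
    obtain rfl : i = 0 := by simpa using hi
    simp [hβ]
  · obtain ⟨i, hij, hi⟩ : ∃ i, i ≠ j ∧ i ∈ range n := by
      rw [mem_range] at hj
      by_cases h0 : j = 0
      · exact ⟨1, by omega, mem_range.2 (by omega)⟩
      · exact ⟨0, by omega, mem_range.2 (by omega)⟩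
    have h5 := hL.add_var_mem hij hi hj h4
    have h6 : pureFn (range n) (-2 * c) 0 (Pi.single i (β j)) ∈ L :=
      combine 1 (-1) h5 (hα (Pi.single j (β j))) (by ring) (fun k _ => by simp) fun k _ => by simp
    have h6 : pureFn (range n) 0 0 (Pi.single i (β j)) ∈ L :=
      combine 1 c h6 h2 (by ring) (fun k _ => by simp) fun k _ => by simp
    refine hL.pureFn_of_single_right hi ?_
    rwa [pureFn_congr (α' := 0) (β' := Pi.single i 1) (c' := 0) rfl (fun _ _ => rfl) fun k _ => ?_]
      at h6
    by_cases hk : k = i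
    · subst hk; simp [hβ]
    · simp [hk]

/-- With the converse `vFn_of_full`, this shows that `2 vₙ₊₁` in `n + 1` variables encodes the
presence of all pure functions of `n` variables with even leading coefficient. -/
theorem full_of_vFn (hL : Closed L) (hn : 2 ≤ n) (h : vFn (n + 1) ∈ L) : Full L n := by
  have h0 : 0 ∈ range n := mem_range.2 (by omega)
  have h1 : 1 ∈ range n := mem_range.2 (by omega)
  have h2 : pureFn (range (n + 1)) 2 0 0 ∈ L :=
    hL.two_mem_of_odd (i := 0) (mem_range.2 (by omega)) h (by simp)
  have h3 : pureFn (range (n + 1)) 0 (Pi.single 0 1 + Pi.single 1 1) 0 ∈ L :=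
    combine 1 (-1) h h2 (by ring) (fun i _ => by simp) fun i _ => by simp
  rw [Finset.range_add_one] at h3
  exact hL.full_of_odd h0 (by simp) (hL.identify_var_mem zero_ne_one h0 h1 (by simp) h3)

theorem vFn_of_full (hL : Closed L) (hn : 2 ≤ n) (h : Full L n) : vFn (n + 1) ∈ L := by
  have h1 := hL.add_new_var_mem (i := 0) (k := n) (mem_range.2 (by omega)) (by simp)
    (h.right (Pi.single 0 1))
  rw [← Finset.range_add_one] at h1
  have h2 := hL.swap_mem (i := n) (j := 1) (mem_range.2 (by omega)) (mem_range.2 (by omega)) h1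
  rw [Pi.add_comp, single_comp_swap, single_comp_swap, Equiv.swap_apply_left,
    Equiv.swap_apply_of_ne_of_ne (by omega) (by omega)] at h2
  exact combine 1 1 h2 (hL.two_mem_of_odd (i := 0) (mem_range.2 (by omega)) h2 (by simp))
    (by ring) (fun i _ => by simp) fun i _ => by simp

/-- `L` is full in `n` variables. If `c` is odd, or if `n = 1`, it also contains `pureFn (range n) 1
0 0`, hence everything in `n` variables, and `2 qₙ` generates all of this in `M`. Otherwise `2 vₙ₊₁`
suffices. -/
theorem transfer_of_odd (hL : Closed L) (hM : Closed M) (hLM : Transfer L M) (hj : j ∈ range n)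
    (hβ : 4 * β j = 4) (h : pureFn (range n) c α β ∈ L) : pureFn (range n) c α β ∈ M := by
  have hn : 1 ≤ n := by rw [mem_range] at hj; omega
  have hF := hL.full_of_odd hj hβ h
  have key : pureFn (range n) 1 0 0 ∈ L → pureFn (range n) c α β ∈ M := by
    intro h1
    have hq : qFn n ∈ M := hLM.q n hn (hF.mem_of_one_mem h1 _ _ _)
    have hF' := hM.full_of_odd (j := 0) (mem_range.2 hn) (by simp) hq
    exact hF'.mem_of_one_mem (hF'.one_mem (by ring) hq) c α β
  rcases four_mul_eq c with hc | hc
  · by_cases h1 : n = 1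
    · subst h1
      exact key (hL.one_mem_of_single (hF.left _))
    · have hn2 : 2 ≤ n := by omega
      exact (hM.full_of_vFn hn2 (hLM.v _ (by omega) (hL.vFn_of_full hn2 hF))).mem_of_even hc α β
  · exact key (hF.one_mem hc h)

/-! ### Pure functions with `β = 0` -/

/-- If two of the coefficients `α i` differ modulo `2`, then exchanging their variables and
subtracting yields `2 vₙ`. -/
theorem vFn_mem_of_mixed (hL : Closed L) (hi : i ∈ range n) (hα : 4 * α i ≠ 4 * α 0)
    (h : pureFn (range n) c α 0 ∈ L) : vFn n ∈ L := by
  have hi0 : i ≠ 0 := by rintro rfl; exact hα rfl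
  rw [mem_range] at hi
  have h1 := hL.swap_mem (i := 0) (j := i) (mem_range.2 (by omega)) (mem_range.2 hi) h
  have h2 : pureFn (range n) 0 (Pi.single 0 1 + Pi.single i 1) 0 ∈ L := by
    refine combine 1 (-1) h1 h (by ring) (fun k _ => ?_) (by simp)
    rcases four_mul_eq (α i) with ha | ha <;> rcases four_mul_eq (α 0) with hb | hb <;>
      rw [ha, hb] at hα
    · exact absurd rfl hα
    · by_cases hk : k = 0
      · subst hk; simp [Pi.single_eq_of_ne hi0.symm]; linear_combination hb - ha + eight_eq_zero
      by_cases hk' : k = i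
      · subst hk'; simp [hk]; linear_combination ha - hb
      · simp [hk, hk', Equiv.swap_apply_of_ne_of_ne]
    · by_cases hk : k = 0
      · subst hk; simp [Pi.single_eq_of_ne hi0.symm]; linear_combination hb - ha
      by_cases hk' : k = i
      · subst hk'; simp [hk]; linear_combination ha - hb + eight_eq_zero
      · simp [hk, hk', Equiv.swap_apply_of_ne_of_ne]
    · exact absurd rfl hα
  have h3 := hL.swap_mem (i := i) (j := 1) (mem_range.2 hi) (mem_range.2 (by omega)) h2
  rw [Pi.add_comp, single_comp_swap, single_comp_swap, Equiv.swap_apply_left,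
    Equiv.swap_apply_of_ne_of_ne hi0.symm (by omega)] at h3
  exact combine 1 1 h3 (hL.two_mem_of_odd (i := 0) (mem_range.2 (by omega)) h3 (by simp))
    (by ring) (fun i _ => by simp) fun i _ => by simp

theorem two_mem_of_vFn (hL : Closed L) (hn : 1 ≤ n) (h : vFn n ∈ L) :
    pureFn (range n) 2 0 0 ∈ L :=
  hL.two_mem_of_odd (i := 0) (mem_range.2 hn) h (by simp)

/-- Permuting `2 vₙ` gives a pair of unit coefficients at `i` and 0 for each `i`, so all
coefficients `α i` can be moved to index 0. -/
theorem pureFn_of_vFn (hL : Closed L) (hn : 2 ≤ n) (h : vFn n ∈ L) (α : ℕ → ZMod 8) :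
    pureFn (range n) 0 (α + Pi.single 0 (∑ i ∈ range n, α i)) 0 ∈ L := by
  have h0 : 0 ∈ range n := mem_range.2 (by omega)
  have h1 : pureFn (range n) 0 (Pi.single 0 1 + Pi.single 1 1) 0 ∈ L :=
    combine 1 (-1) h (hL.two_mem_of_vFn (by omega) h) (by ring) (fun i _ => by simp)
      fun i _ => by simp
  have h2 : ∀ i ∈ range n, pureFn (range n) 0 (Pi.single i 1 + Pi.single 0 1) 0 ∈ L := by
    intro i hi
    by_cases hi0 : i = 0
    · subst hi0
      refine combine 0 0 h1 h1 (by ring) (fun k _ => ?_) fun k _ => by simp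
      simp only [Pi.add_apply]
      linear_combination ((Pi.single 0 1 : ℕ → ZMod 8) k) * eight_eq_zero
    · have := hL.swap_mem (i := 1) (j := i) (mem_range.2 (by omega)) hi h1
      rwa [Pi.add_comp, single_comp_swap, single_comp_swap, Equiv.swap_apply_left,
        Equiv.swap_apply_of_ne_of_ne (by omega) (by omega), add_comm] at this
  have h3 := L.sum_mem fun i hi => smul_mem (α i) (h2 i hi)
  simp only [pureFn_smul] at h3
  rw [pureFn_sum] at h3
  convert h3 using 1
  refine pureFn_congr (by simp) (fun i hi => ?_) fun i _ => ?_
  · simp only [Finset.sum_apply, Pi.add_apply, Pi.smul_apply, smul_eq_mul, mul_add,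
      Finset.sum_add_distrib]
    simp only [Pi.single_apply, mul_ite, mul_one, mul_zero, Finset.sum_ite_eq, hi, if_true]
    by_cases hi0 : i = 0 <;> simp [hi0]
  · simp

/-- Modulo `vₙ`, only the parity of the sum of the coefficients matters. -/
theorem pureFn_of_vFn_of_sum_eq (hL : Closed L) (hn : 2 ≤ n) (h : vFn n ∈ L)
    (hs : 4 * ∑ i ∈ range n, α i = 4 * ∑ i ∈ range n, α' i) (h' : pureFn (range n) c α' 0 ∈ L) :
    pureFn (range n) c α 0 ∈ L := by
  refine combine 1 1 h' (hL.pureFn_of_vFn hn h (α - α')) (by ring) (fun i _ => ?_) (by simp)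
  by_cases hi : i = 0
  · subst hi
    simp
    linear_combination -hs
  · simp [hi]

/-- In the presence of `2 vₙ` a function is classified by the parities of `c` and of the sum of `α`.
For even `c` it follows from `2 vₙ` alone or from `2 uₙ`; for odd `c` it is equivalent to `2 rₙ` or
`2 pₙ`. -/
theorem transfer_of_vFn (hL : Closed L) (hM : Closed M) (hLM : Transfer L M) (hn : 2 ≤ n)
    (hv : vFn n ∈ L) (h : pureFn (range n) c α 0 ∈ L) : pureFn (range n) c α 0 ∈ M := by
  have hv' := hLM.v n hn hv
  have h0 : 0 ∈ range n := mem_range.2 (by omega)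
  have h2' := hM.two_mem_of_vFn (by omega) hv'
  have h2 := hL.two_mem_of_vFn (by omega) hv
  have sum_single : ∑ i ∈ range n, (Pi.single 0 1 : ℕ → ZMod 8) i = 1 := by
    simp [Pi.single_apply, show n ≠ 0 by omega]
  rcases four_mul_eq c with hc | hc
  · rcases four_mul_eq (∑ i ∈ range n, α i) with hs | hs
    · exact hM.pureFn_of_vFn_of_sum_eq (α' := 0) hn hv' (by simpa using hs) (pureFn_of_two h2' hc)
    · have hu : uFn n ∈ M := by
        refine hLM.u n (by omega) ?_
        refine hL.pureFn_of_vFn_of_sum_eq (α' := α) hn hv (by rw [sum_single, hs]; norm_num) ?_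
        exact combine 1 1 h (pureFn_of_two (c := 2 - c) h2 (by linear_combination -hc + eight_eq_zero))
          (by ring) (fun i _ => by simp) fun i _ => by simp
      refine hM.pureFn_of_vFn_of_sum_eq (α' := Pi.single 0 1) hn hv'
        (by rw [sum_single, hs]; norm_num) ?_
      exact combine 1 1 hu (pureFn_of_two (c := c - 2) h2' (by linear_combination hc - eight_eq_zero))
        (by ring) (fun i _ => by simp) fun i _ => by simp
  -- Multiplication by the odd `c` normalises the leading coefficient, since `c * c = 1`, and does
  -- not change `α` modulo 2.
  · have hf : pureFn (range n) 1 α 0 ∈ L := by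
      refine combine c 0 h h (by rw [mul_self_of_odd hc]; ring) (fun i _ => ?_) fun i _ => by simp
      linear_combination -α i * hc
    suffices hf' : pureFn (range n) 1 α 0 ∈ M by
      refine combine c 0 hf' hf' (by ring) (fun i _ => ?_) fun i _ => by simp
      linear_combination -α i * hc
    by_cases hs : 4 * ∑ i ∈ range n, α i = 4 * ∑ i ∈ range n, (1 : ℕ → ZMod 8) i
    · exact hM.pureFn_of_vFn_of_sum_eq hn hv' hs
        (hLM.r n (by omega) (hL.pureFn_of_vFn_of_sum_eq hn hv hs.symm hf))
    · have hs' : 4 * ∑ i ∈ range n, α i =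
          4 * ∑ i ∈ range n, (1 + Pi.single 0 1 : ℕ → ZMod 8) i := by
        simp only [Pi.add_apply, Finset.sum_add_distrib, sum_single]
        revert hs
        generalize ∑ i ∈ range n, α i = a
        simp only [Pi.one_apply]
        generalize ∑ i ∈ range n, (1 : ZMod 8) = b
        revert a b
        decide
      exact hM.pureFn_of_vFn_of_sum_eq hn hv' hs'
        (hLM.p n (by omega) (hL.pureFn_of_vFn_of_sum_eq hn hv hs'.symm hf))

/-- Pure functions of the first `n` variables belong to `M` if the generators do. -/
theorem transfer_range (hL : Closed L) (hM : Closed M) (hLM : Transfer L M) (hn : 1 ≤ n)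
    (h : pureFn (range n) c α β ∈ L) : pureFn (range n) c α β ∈ M := by
  have h0 : 0 ∈ range n := mem_range.2 hn
  by_cases hβ : ∃ j ∈ range n, 4 * β j = 4
  · obtain ⟨j, hj, hβ⟩ := hβ
    exact hL.transfer_of_odd hM hLM hj hβ h
  have hβ : ∀ i ∈ range n, 4 * β i = 4 * (0 : ℕ → ZMod 8) i := fun i hi => by
    have := (four_mul_eq (β i)).resolve_right fun h => hβ ⟨i, hi, h⟩
    simpa using this
  rw [pureFn_congr (c' := c) (α' := α) rfl (fun _ _ => rfl) hβ] at h ⊢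
  by_cases hα : ∃ i ∈ range n, 4 * α i ≠ 4 * α 0
  · obtain ⟨i, hi, hα⟩ := hα
    have hn2 : 2 ≤ n := by
      by_contra hlt
      obtain rfl : i = 0 := by rw [mem_range] at hi; omega
      exact hα rfl
    exact hL.transfer_of_vFn hM hLM hn2 (hL.vFn_mem_of_mixed hi hα h) h
  push Not at hα
  rcases four_mul_eq (α 0) with ha | ha
  -- All `α i` are even: only a multiple of `2 ∏ bit₀ (x i)` remains, which is zero or equivalent to
  -- `4 rₙ` or `2 sₙ`.
  · have hα' : ∀ i ∈ range n, 4 * α i = 4 * (0 : ℕ → ZMod 8) i := fun i hi => by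
      rw [hα i hi, ha]; simp
    rw [pureFn_congr (c' := c) (β' := 0) rfl hα' fun _ _ => rfl] at h ⊢
    rcases four_mul_eq c with hc | hc
    · obtain ⟨d, rfl⟩ := exists_eq_two_mul hc
      rcases four_mul_eq d with hd | hd
      · rw [pureFn_congr (c' := 0) (α' := 0) (β' := 0) (by linear_combination hd) (fun _ _ => rfl)
          fun _ _ => rfl]
        have : pureFn (range n) 0 0 0 = 0 := by funext x; simp [pureFn_zero_zero]
        rw [this]
        exact M.zero_mem
      · rw [pureFn_congr (c' := 2) (α' := 0) (β' := 0) (by linear_combination hd) (fun _ _ => rfl)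
          fun _ _ => rfl] at h ⊢
        exact hLM.e n hn h
    · have hs := hLM.s n hn ?_
      · refine combine (c * (sCoeff n)) 0 hs hs ?_ (by simp) (by simp)
        linear_combination -2 * c * mul_self_of_odd (four_mul_sCoeff n)
      · refine combine (c * (sCoeff n)) 0 h h ?_ (by simp) (by simp)
        linear_combination -2 * sCoeff n * mul_self_of_odd hc
  -- All `α i` are odd, so `4 rₙ` is present and even leading coefficients can be exchanged freely:
  -- even `c` is equivalent to `2 tₙ`, odd `c` to `2 rₙ`.
  · have hα' : ∀ i ∈ range n, 4 * α i = 4 * (1 : ℕ → ZMod 8) i := fun i hi => by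
      rw [hα i hi, ha]; simp
    rw [pureFn_congr (c' := c) (β' := 0) rfl hα' fun _ _ => rfl] at h ⊢
    rcases four_mul_eq c with hc | hc
    · have hc' := four_mul_tCoeff n
      have ht := hLM.t n hn (combine 1 1 h (pureFn_of_two
        (c := (tCoeff n) - c) (hL.two_mem_of_odd h0 h (by simp))
        (by linear_combination hc' - hc)) (by ring) (fun i _ => by simp) fun i _ => by simp)
      exact combine 1 1 ht (pureFn_of_two
        (c := c - (tCoeff n)) (hM.two_mem_of_odd h0 ht (by simp))
        (by linear_combination hc - hc')) (by ring) (fun i _ => by simp) fun i _ => by simp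
    · have hr : rFn n ∈ M := by
        refine hLM.r n hn (combine c 0 h h (by rw [mul_self_of_odd hc]; ring) (fun i _ => ?_)
          fun i _ => by simp)
        linear_combination -(1 : ℕ → ZMod 8) i * hc
      refine combine c 0 hr hr (by ring) (fun i _ => ?_) fun i _ => by simp
      linear_combination -(1 : ℕ → ZMod 8) i * hc

theorem _root_.Finset.exists_rename {A B : Finset ℕ} (h : A.card = B.card) :
    ∃ σ τ : ℕ → ℕ, (∀ i ∈ A, τ (σ i) = i) ∧ (∀ i ∈ B, σ (τ i) = i) ∧ A.image σ = B ∧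
      B.image τ = A := by
  let e := Finset.equivOfCardEq h
  have h1 : ∀ i (hi : i ∈ A), (if h : i ∈ A then (e ⟨i, h⟩ : ℕ) else 0) = e ⟨i, hi⟩ :=
    fun i hi => dif_pos hi
  have h2 : ∀ i (hi : i ∈ B), (if h : i ∈ B then (e.symm ⟨i, h⟩ : ℕ) else 0) = e.symm ⟨i, hi⟩ :=
    fun i hi => dif_pos hi
  have h3 : ∀ i ∈ A, (if h : i ∈ A then (e ⟨i, h⟩ : ℕ) else 0) ∈ B := fun i hi => by
    rw [h1 i hi]; exact (e ⟨i, hi⟩).2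
  have h4 : ∀ i ∈ B, (if h : i ∈ B then (e.symm ⟨i, h⟩ : ℕ) else 0) ∈ A := fun i hi => by
    rw [h2 i hi]; exact (e.symm ⟨i, hi⟩).2
  have h5 : ∀ i ∈ A, (fun i => if h : i ∈ B then (e.symm ⟨i, h⟩ : ℕ) else 0)
      ((fun i => if h : i ∈ A then (e ⟨i, h⟩ : ℕ) else 0) i) = i := fun i hi => by
    simp [hi]
  have h6 : ∀ i ∈ B, (fun i => if h : i ∈ A then (e ⟨i, h⟩ : ℕ) else 0)
      ((fun i => if h : i ∈ B then (e.symm ⟨i, h⟩ : ℕ) else 0) i) = i := fun i hi => by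
    simp [hi]
  refine ⟨fun i => if h : i ∈ A then (e ⟨i, h⟩ : ℕ) else 0,
    fun i => if h : i ∈ B then (e.symm ⟨i, h⟩ : ℕ) else 0, h5, h6, ?_, ?_⟩
  · ext k
    rw [Finset.mem_image]
    exact ⟨fun ⟨i, hi, hk⟩ => hk ▸ h3 i hi, fun hk => ⟨_, h4 k hk, h6 k hk⟩⟩
  · ext k
    rw [Finset.mem_image]
    exact ⟨fun ⟨i, hi, hk⟩ => hk ▸ h4 i hi, fun hk => ⟨_, h3 k hk, h5 k hk⟩⟩

/-- Pure functions belong to `M` if the generators do. -/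
theorem transfer (hL : Closed L) (hM : Closed M) (hLM : Transfer L M)
    (h : pureFn A c α β ∈ L) : pureFn A c α β ∈ M := by
  rcases A.eq_empty_or_nonempty with rfl | hA
  · rw [pureFn_empty]
    exact hM.const _
  obtain ⟨σ, τ, h1, h2, h3, h4⟩ := Finset.exists_rename (Finset.card_range A.card).symm
  have h5 := hM.rename h2 h4 (hL.transfer_range hM hLM hA.card_pos (hL.rename h1 h3 h))
  rwa [pureFn_congr (c' := c) (α' := α) (β' := β) rfl (fun i hi => ?_) fun i hi => ?_] at h5 <;>
    simp [h1 i hi]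

end Closed

end CloneZ8

namespace CloneZ8

open Finset (range mem_range)

variable {A : Finset ℕ} {c : ZMod 8} {α β : ℕ → ZMod 8} {x : ℕ → ZMod 8} {i j : ℕ}
  {L : AddSubgroup Fn} {n : ℕ}

/-! ### Doubled monomials -/

/-- The coefficient of the last but one digit of `x` in `2 x ^ k`. -/
def powCoeff (k : ℕ) : ZMod 8 := if k = 1 then 1 else 0

/-- The coefficient of the product of the last two digits of `x` in `2 x ^ k`. -/
def powCoeff' (k : ℕ) : ZMod 8 := if Odd k ∧ k ≠ 1 then 1 else 0

theorem two_mul_pow {k : ℕ} (hk : k ≠ 0) (a : ZMod 8) :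
    2 * a ^ k = 2 * bit₀ a + 4 * bit₁ a * (powCoeff k + powCoeff' k * bit₀ a) := by
  induction k using Nat.strong_induction_on with
  | _ k ih =>
    rcases lt_or_ge k 4 with hlt | hge
    · have : k = 1 ∨ k = 2 ∨ k = 3 := by omega
      rcases this with rfl | rfl | rfl <;> revert a <;> decide
    · obtain ⟨m, rfl⟩ : ∃ m, k = m + 4 := ⟨k - 4, by omega⟩
      have h := ih (m + 2) (by omega) (by omega)
      -- Since `a⁴ ≡ a²` modulo 4, exponents from 4 on can be lowered by 2.
      have d : ∀ a : ZMod 8, 2 * a ^ 4 = 2 * a ^ 2 := by decide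
      have e1 : powCoeff (m + 4) = powCoeff (m + 2) := by simp [powCoeff]
      have e2 : powCoeff' (m + 4) = powCoeff' (m + 2) := by
        simp [powCoeff', Nat.odd_add, show Even 4 by decide]
      rw [e1, e2, ← h]
      linear_combination a ^ m * d a

theorem two_mul_prod_pow {e : ℕ → ℕ} (he : ∀ i ∈ A, e i ≠ 0) (x : ℕ → ZMod 8) :
    2 * ∏ i ∈ A, x i ^ e i = pureFn A 1 (powCoeff ∘ e) (powCoeff' ∘ e) x := by
  induction A using Finset.induction_on with
  | empty => simp [pureFn_empty]
  | insert i A hi ih =>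
    have h1 := ih fun j hj => he j (Finset.mem_insert_of_mem hj)
    have h2 := two_mul_pow (he i (Finset.mem_insert_self _ _)) (x i)
    have h3 := two_mul_pureFn A 1 (powCoeff ∘ e) (powCoeff' ∘ e) x
    rw [Finset.prod_insert hi, pureFn_insert hi, ← h1] at *
    simp only [Function.comp_apply]
    linear_combination (∏ j ∈ A, x j ^ e j) * h2 +
      bit₁ (x i) * (powCoeff (e i) + powCoeff' (e i) * bit₀ (x i)) * h3

theorem two_mul_prod (A : Finset ℕ) (x : ℕ → ZMod 8) : 2 * ∏ i ∈ A, x i = pureFn A 1 1 0 x := by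
  have h := two_mul_prod_pow (A := A) (e := fun _ => 1) (fun _ _ => one_ne_zero) x
  simp only [pow_one] at h
  rw [h]
  exact congrFun (pureFn_congr rfl (fun i _ => by simp [powCoeff]) fun i _ => by simp [powCoeff']) x

theorem two_mul_prod_mul_pow (hj : j ∈ A) (m : ℕ) (x : ℕ → ZMod 8) :
    2 * ((∏ i ∈ A, x i) * x j ^ m) =
      pureFn A 1 (powCoeff ∘ (1 + Pi.single j m)) (powCoeff' ∘ (1 + Pi.single j m)) x := by
  rw [← two_mul_prod_pow fun i _ => by simp]
  congr 1
  simp only [Pi.add_apply, pow_add, Finset.prod_mul_distrib, Pi.one_apply, pow_one]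
  congr 1
  rw [Finset.prod_eq_single_of_mem j hj fun i _ hi => by simp [hi]]
  simp

theorem two_mul_prod_mul_var (hj : j ∈ A) (x : ℕ → ZMod 8) :
    2 * ((∏ i ∈ A, x i) * x j) = pureFn A 1 (1 + Pi.single j 1) 0 x := by
  have h := two_mul_prod_mul_pow hj 1 x
  rw [pow_one] at h
  rw [h, pureFn_congr rfl (fun i _ => ?_) fun i _ => ?_]
  · by_cases hi : i = j
    · subst hi; simp [powCoeff]; decide
    · simp [powCoeff, hi]
  · by_cases hi : i = j
    · subst hi; simp [powCoeff']
    · simp [powCoeff', hi]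

/-- The coefficients `n` and `n + 1` have opposite parities, and adding the product itself exchanges
these parities. This explains the case distinction in `t` (even leading coefficient, odd `α`) and
`s` (odd leading coefficient, even `α`). -/
theorem two_mul_prod_mul_sum (n : ℕ) (x : ℕ → ZMod 8) :
    2 * ((∏ i ∈ range n, x i) * ∑ i ∈ range n, x i) =
      pureFn (range n) n (fun _ => n + 1) 0 x := by
  rw [Finset.mul_sum, Finset.mul_sum, Finset.sum_congr rfl fun j hj => two_mul_prod_mul_var hj x,
    ← Finset.sum_apply, pureFn_sum]
  refine congrFun (pureFn_congr ?_ (fun i hi => ?_) fun i _ => ?_) x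
  · simp
  · rw [mem_range] at hi
    simp [Finset.sum_apply, Finset.sum_add_distrib, Pi.single_apply, hi]
  · simp

theorem prod_fin (x : ℕ → ZMod 8) : ∏ i : Fin n, x i = ∏ i ∈ range n, x i :=
  Fin.prod_univ_eq_prod_range _ _

theorem sum_fin (x : ℕ → ZMod 8) : ∑ i : Fin n, x i = ∑ i ∈ range n, x i :=
  Fin.sum_univ_eq_sum_range _ _

theorem lift_two_mul_r (n : ℕ) : lift (2 * r n) = rFn n := by
  funext x
  rw [rFn, ← two_mul_prod, ← prod_fin]
  rfl

theorem lift_four_mul_r (n : ℕ) : lift (4 * r n) = eFn n := by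
  have h : lift (4 * r n) = (2 : ZMod 8) • lift (2 * r n) := by
    funext x
    simp only [lift, Pi.mul_apply, Pi.smul_apply, smul_eq_mul, Pi.ofNat_apply]
    ring
  rw [h, lift_two_mul_r, rFn, pureFn_smul]
  exact pureFn_congr (by simp) (fun i _ => by simp; decide) fun i _ => by simp

theorem lift_two_mul_p (hn : 1 ≤ n) : lift (2 * p n) = pFn n := by
  funext x
  rw [pFn, ← two_mul_prod_mul_var (mem_range.2 hn), ← prod_fin]
  simp [lift, p, var, show 0 < n from hn]

theorem lift_two_mul_q (hn : 1 ≤ n) : lift (2 * q n) = qFn n := by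
  funext x
  have h := two_mul_prod_mul_pow (mem_range.2 hn) 2 x
  rw [← prod_fin] at h
  have h' : lift (2 * q n) x = 2 * ((∏ i : Fin n, x i) * x 0 ^ 2) := by
    simp [lift, q, var, show 0 < n from hn]
  rw [h', h, qFn]
  refine congrFun (pureFn_congr rfl (fun i _ => ?_) fun i _ => ?_) x
  · by_cases hi : i = 0
    · subst hi; simp [powCoeff]; decide
    · simp [powCoeff, hi]
  · by_cases hi : i = 0
    · subst hi; simp [powCoeff']; decide
    · simp [powCoeff', hi]

theorem lift_two_mul_u (hn : 1 ≤ n) : lift (2 * u n) = uFn n := by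
  funext x
  have h' : lift (2 * u n) x = 2 * ((∏ i : Fin n, x i) * x 0) + 2 * ∏ i : Fin n, x i := by
    simp [lift, u, var, show 0 < n from hn]
    ring
  rw [h', prod_fin, two_mul_prod_mul_var (mem_range.2 hn), two_mul_prod, ← Pi.add_apply,
    pureFn_add, uFn]
  refine congrFun (pureFn_congr (by norm_num) (fun i _ => ?_) fun i _ => by simp) x
  simp only [Pi.add_apply, Pi.one_apply]
  linear_combination eight_eq_zero

theorem lift_two_mul_v (hn : 2 ≤ n) : lift (2 * v n) = vFn n := by
  funext x
  have h' : lift (2 * v n) x =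
      2 * ((∏ i : Fin n, x i) * x 0) + 2 * ((∏ i : Fin n, x i) * x 1) := by
    simp [lift, v, var, show 0 < n by omega, show 1 < n by omega]
    ring
  rw [h', prod_fin, two_mul_prod_mul_var (mem_range.2 (by omega)),
    two_mul_prod_mul_var (mem_range.2 (by omega)), ← Pi.add_apply, pureFn_add, vFn]
  refine congrFun (pureFn_congr (by norm_num) (fun i _ => ?_) fun i _ => by simp) x
  simp only [Pi.add_apply, Pi.one_apply]
  linear_combination eight_eq_zero

theorem lift_two_mul_prod_mul_sum_add_one (n : ℕ) (x : ℕ → ZMod 8) :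
    2 * ((∏ i : Fin n, x i) * ((∑ i : Fin n, x i) + 1)) =
      pureFn (range n) (n + 1) (fun _ => n) 0 x := by
  rw [mul_add, mul_add, mul_one, prod_fin, sum_fin, two_mul_prod_mul_sum, two_mul_prod,
    ← Pi.add_apply, pureFn_add]
  refine congrFun (pureFn_congr rfl (fun i _ => ?_) fun i _ => by simp) x
  simp only [Pi.add_apply, Pi.one_apply]
  linear_combination eight_eq_zero

theorem lift_two_mul_t (n : ℕ) : lift (2 * t n) = tFn n := by
  funext x
  by_cases hn : Even n
  · have h' : lift (2 * t n) x = 2 * ((∏ i : Fin n, x i) * ∑ i : Fin n, x i) := by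
      simp [lift, t, hn]
    rw [h', prod_fin, sum_fin, two_mul_prod_mul_sum, tFn, tCoeff, if_pos hn]
    refine congrFun (pureFn_congr rfl (fun i _ => ?_) fun i _ => rfl) x
    rw [mul_add, four_mul_cast_even hn, zero_add]
    rfl
  · have h' : lift (2 * t n) x = 2 * ((∏ i : Fin n, x i) * ((∑ i : Fin n, x i) + 1)) := by
      simp [lift, t, hn]
    rw [h', lift_two_mul_prod_mul_sum_add_one, tFn, tCoeff, if_neg hn]
    refine congrFun (pureFn_congr rfl (fun i _ => ?_) fun i _ => rfl) x
    rw [four_mul_cast_odd (Nat.not_even_iff_odd.1 hn)]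
    simp

theorem lift_two_mul_s (n : ℕ) : lift (2 * s n) = sFn n := by
  funext x
  by_cases hn : Odd n
  · have h' : lift (2 * s n) x = 2 * ((∏ i : Fin n, x i) * ∑ i : Fin n, x i) := by
      simp [lift, s, hn]
    rw [h', prod_fin, sum_fin, two_mul_prod_mul_sum, sFn, sCoeff, if_pos hn]
    refine congrFun (pureFn_congr rfl (fun i _ => ?_) fun i _ => rfl) x
    rw [mul_add, four_mul_cast_odd hn]
    rfl
  · have h' : lift (2 * s n) x = 2 * ((∏ i : Fin n, x i) * ((∑ i : Fin n, x i) + 1)) := by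
      simp [lift, s, hn]
    rw [h', lift_two_mul_prod_mul_sum_add_one, sFn, sCoeff, if_neg hn]
    refine congrFun (pureFn_congr rfl (fun i _ => ?_) fun i _ => rfl) x
    rw [four_mul_cast_even (Nat.not_odd_iff_even.1 hn)]
    simp

/-! ### Each family is closed downwards -/

namespace Closed

theorem range_pred (hL : Closed L) (h : pureFn (range (n + 1)) c α β ∈ L) :
    pureFn (range n) c α β ∈ L := by
  -- The value 1 has last digit 1 and next digit 0, so the last variable disappears and the other
  -- coefficients stay.
  have h1 := hL.update_mem n h (hL.const 1)
  convert h1 using 1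
  funext x
  have e1 : bit₀ 1 = 1 := by decide
  have e2 : bit₁ 1 = 0 := by decide
  rw [Finset.range_add_one, pureFn_insert (by simp), pureFn_update (by simp),
    Function.update_self, e1, e2]
  ring

theorem tFn_pred (hL : Closed L) (hn : 1 ≤ n) (h : tFn (n + 1) ∈ L) : tFn n ∈ L := by
  have h1 := hL.range_pred h
  -- The leading coefficients for `n` and `n + 1` may differ, but both are even; the odd
  -- coefficients `α` provide `4 ∏ xᵢ` to correct this.
  refine combine 1 1 h1 (pureFn_of_two (c := tCoeff n - tCoeff (n + 1))
    (hL.two_mem_of_odd (i := 0) (mem_range.2 hn) h1 (by simp)) ?_) (by ring) (fun i _ => by simp)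
    fun i _ => by simp
  linear_combination four_mul_tCoeff n - four_mul_tCoeff (n + 1)

theorem sFn_pred (hL : Closed L) (h : sFn (n + 1) ∈ L) : sFn n ∈ L := by
  have h1 := hL.range_pred h
  refine combine (sCoeff n * sCoeff (n + 1)) 0 h1 h1 ?_ (fun i _ => by simp) fun i _ => by simp
  linear_combination -2 * sCoeff n * mul_self_of_odd (four_mul_sCoeff (n + 1))

end Closed

/-! ### Decomposition of polynomials with even nonlinear coefficients -/

/-- Sums of an affine function and pure functions of the first `n` variables. -/
def Decomposes (n : ℕ) (f : Fn) : Prop :=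
  ∃ g : Fn, (∀ L, Closed L → g ∈ L) ∧ ∃ (c : Finset ℕ → ZMod 8) (α β : Finset ℕ → ℕ → ZMod 8),
    f = g + ∑ A ∈ (range n).powerset, pureFn A (c A) (α A) (β A)

namespace Decomposes

theorem add {f g : Fn} (hf : Decomposes n f) (hg : Decomposes n g) : Decomposes n (f + g) := by
  obtain ⟨f', hf', c, α, β, rfl⟩ := hf
  obtain ⟨g', hg', c', α', β', rfl⟩ := hg
  refine ⟨f' + g', fun L hL => L.add_mem (hf' L hL) (hg' L hL), c + c', α + α', β + β', ?_⟩
  simp only [Pi.add_apply, ← pureFn_add, Finset.sum_add_distrib]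
  abel

theorem of_forall_mem {g : Fn} (hg : ∀ L, Closed L → g ∈ L) : Decomposes n g := by
  refine ⟨g, hg, 0, 0, 0, ?_⟩
  have h : ∀ A, pureFn A 0 0 0 = 0 := fun A => by
    funext x; simp [pureFn]
  simp [h]

theorem of_pureFn (hA : A ⊆ range n) (c : ZMod 8) (α β : ℕ → ZMod 8) :
    Decomposes n (pureFn A c α β) := by
  refine ⟨0, fun L _ => L.zero_mem, Pi.single A c, Pi.single A α, Pi.single A β, ?_⟩
  rw [zero_add, Finset.sum_eq_single_of_mem A (Finset.mem_powerset.2 hA)]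
  · simp
  · intro B _ hB
    funext x
    simp [hB, pureFn]

theorem sum {ι : Type*} (S : Finset ι) {f : ι → Fn} (h : ∀ i ∈ S, Decomposes n (f i)) :
    Decomposes n (∑ i ∈ S, f i) := by
  classical
  induction S using Finset.induction_on with
  | empty => exact of_forall_mem fun L _ => by simp
  | insert i S hi ih =>
    rw [Finset.sum_insert hi]
    exact (h i (by simp)).add (ih fun j hj => h j (by simp [hj]))

end Decomposes

/-- Terms of degree at most 1 lie in every closed group. Any other term is a multiple of a doubled
monomial, hence pure in the set of variables that occur in it. -/
theorem HasEvenNonlinear.decomposes {f : Op (ZMod 8) n} (hf : HasEvenNonlinear f) :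
    Decomposes n (lift f) := by
  obtain ⟨P, hP, hf⟩ := hf
  have h : lift f = ∑ d ∈ P.support, lift fun x => P.coeff d * ∏ i, x i ^ d i := by
    funext x
    rw [Finset.sum_apply, lift, hf, MvPolynomial.eval_eq']
    rfl
  rw [h]
  refine Decomposes.sum _ fun d _ => ?_
  rcases lt_or_ge d.degree 2 with hd | hd
  · refine Decomposes.of_forall_mem fun L hL => ?_
    rcases eq_zero_or_single_of_degree_lt_two hd with rfl | ⟨i, rfl⟩
    · convert hL.const (P.coeff 0) using 1
      funext x
      simp [lift]
    · have e : (lift fun x => P.coeff (Finsupp.single i 1) * ∏ j, x j ^ Finsupp.single i 1 j) =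
          P.coeff (Finsupp.single i 1) • fun x : ℕ → ZMod 8 => x i := by
        funext x
        simp only [lift, Pi.smul_apply, smul_eq_mul]
        rw [Finset.prod_eq_single_of_mem i (Finset.mem_univ i) fun j _ hj => by simp [hj]]
        simp
      rw [e]
      exact Closed.smul_mem _ (hL.coord _)
  · obtain ⟨a, ha⟩ := hP d hd
    let e : ℕ → ℕ := fun i => if h : i < n then d ⟨i, h⟩ else 0
    let A := {i ∈ range n | e i ≠ 0}
    have h' : (lift fun x => P.coeff d * ∏ i, x i ^ d i) =
        a • pureFn A 1 (powCoeff ∘ e) (powCoeff' ∘ e) := by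
      funext x
      rw [Pi.smul_apply, ← two_mul_prod_pow fun i hi => (Finset.mem_filter.1 hi).2, smul_eq_mul]
      have h1 : ∏ i ∈ A, x i ^ e i = ∏ i ∈ range n, x i ^ e i :=
        Finset.prod_subset (Finset.filter_subset _ _) fun i hi hiA => by
          have : e i = 0 := by
            by_contra h
            exact hiA (Finset.mem_filter.2 ⟨hi, h⟩)
          rw [this, pow_zero]
      have h2 : ∏ i : Fin n, x i ^ d i = ∏ i ∈ range n, x i ^ e i := by
        rw [← Fin.prod_univ_eq_prod_range]
        exact Finset.prod_congr rfl fun i _ => by simp [e]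
      rw [h1, ← h2, lift, ha]
      ring
    rw [h', pureFn_smul]
    exact Decomposes.of_pureFn (Finset.filter_subset _ _) _ _ _

/-! ### Joinands -/

theorem C_le {K : Clone (ZMod 8)} (hK : groupPolynomials ≤ K) {f : Op (ZMod 8) n}
    (hf : f ∈ K.ops n) : C f ≤ K := by
  refine sInf_le ?_
  rintro _ ((rfl | rfl) | ⟨a, rfl⟩)
  · exact hf
  · exact hK 2 ⟨by norm_num, 0, fun _ => 1, fun x => by simp⟩
  · exact hK 1 ⟨one_pos, a, 0, fun x => by simp⟩

theorem mem_C (hn : 0 < n) (f : Op (ZMod 8) n) : f ∈ (C f).ops n :=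
  ⟨hn, fun _ hD => hD ⟨n, f⟩ (by simp)⟩

theorem groupPolynomials_le_C (f : Op (ZMod 8) n) : groupPolynomials ≤ C f := by
  refine le_sInf fun D hD => ?_
  have hadd : ∀ {m : ℕ} {g h : Op (ZMod 8) m}, g ∈ D.ops m → h ∈ D.ops m → g + h ∈ D.ops m := by
    intro m g h hg hh
    have h2 : (fun x => x 0 + x 1 : Op (ZMod 8) 2) ∈ D.ops 2 :=
      hD ⟨2, fun x => x 0 + x 1⟩ (by simp)
    exact D.comp_mem (g := ![g, h]) h2 fun i => by fin_cases i <;> assumption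
  intro m g ⟨hm, a₀, a, hg⟩
  have hconst : ∀ b : ZMod 8, (fun _ => b : Op (ZMod 8) m) ∈ D.ops m := fun b =>
    D.comp_mem (f := fun _ : Fin 1 → ZMod 8 => b) (g := fun _ x => x ⟨0, hm⟩)
      (hD ⟨1, fun _ => b⟩ (by simp)) fun _ => D.proj_mem m _
  have hnsmul : ∀ (k : ℕ) {h : Op (ZMod 8) m}, h ∈ D.ops m → k • h ∈ D.ops m := by
    intro k h hh
    induction k with
    | zero => rw [zero_smul]; exact hconst 0
    | succ k ih => rw [succ_nsmul]; exact hadd ih hh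
  have hsum : ∀ S : Finset (Fin m),
      (∑ i ∈ S, (a i : ZMod 8).val • fun x : Fin m → ZMod 8 => x i) ∈ D.ops m := by
    intro S
    induction S using Finset.induction_on with
    | empty => exact hconst 0
    | insert i S hi ih =>
      rw [Finset.sum_insert hi]
      exact hadd (hnsmul _ (D.proj_mem m i)) ih
  convert hadd (hconst a₀) (hsum Finset.univ) using 1
  funext x
  rw [hg]
  simp [Finset.sum_apply]

/-- Because membership passes from `n + 1` to `n`, the indices `n ≥ k` with `f n` in `K` form an
initial segment; its last element, or `⊤`, is the index sought. -/
theorem exists_joinand (f : ∀ n, Op (ZMod 8) n) {k : ℕ} (hk : 1 ≤ k)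
    (hf : ∀ K : Clone (ZMod 8), groupPolynomials ≤ K → ∀ n, k ≤ n → f (n + 1) ∈ K.ops (n + 1) →
      f n ∈ K.ops n) {K : Clone (ZMod 8)} (hK : groupPolynomials ≤ K) :
    ∃ N : ℕ∞, joinand f k N ≤ K ∧ groupPolynomials ≤ joinand f k N ∧
      ∀ n, k ≤ n → f n ∈ K.ops n → f n ∈ (joinand f k N).ops n := by
  have hdown : ∀ K : Clone (ZMod 8), groupPolynomials ≤ K → ∀ m n, k ≤ m → m ≤ n →
      f n ∈ K.ops n → f m ∈ K.ops m := by
    intro K hK m n hkm hmn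
    induction n, hmn using Nat.le_induction with
    | base => exact id
    | succ n hmn ih => exact fun h => ih (hf K hK n (hkm.trans hmn) h)
  by_cases hall : ∀ n, k ≤ n → f n ∈ K.ops n
  · have hle : ∀ n, k ≤ n → C (f n) ≤ joinand f k ⊤ := fun n hn =>
      le_iSup₂_of_le (f := fun n (_ : n ≥ k) => C (f n)) n hn le_rfl
    exact ⟨⊤, iSup₂_le fun n hn => C_le hK (hall n hn),
      (groupPolynomials_le_C (f k)).trans (hle k le_rfl),
      fun n hn _ => hle n hn n (mem_C (by omega) _)⟩
  · classical
    have hex : ∃ n, k ≤ n ∧ f n ∉ K.ops n := by simpa using hall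
    obtain ⟨hb, hb'⟩ := Nat.find_spec hex
    set b := Nat.find hex with hbdef
    have hlt : ∀ n, k ≤ n → f n ∈ K.ops n → n < b := fun n hn hfn => by
      by_contra hge
      exact hb' (hdown K hK b n hb (by omega) hfn)
    by_cases hbk : b = k
    -- No member of the family lies in `K`; since `k ≥ 1`, index 0 makes the joinand absent.
    · have h0 : joinand f k (0 : ℕ) = groupPolynomials := if_neg (by omega)
      refine ⟨(0 : ℕ), ?_, ?_, fun n hn hfn => ?_⟩
      · rwa [h0]
      · rw [h0]
      · have := hlt n hn hfn
        omega
    · have h0 : joinand f k ((b - 1 : ℕ) : ℕ∞) = C (f (b - 1)) := if_pos (by omega)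
      have hmem : f (b - 1) ∈ K.ops (b - 1) := by
        have := Nat.find_min hex (m := b - 1) (by omega)
        by_contra h
        exact this ⟨by omega, h⟩
      refine ⟨((b - 1 : ℕ) : ℕ∞), ?_, ?_, fun n hn hfn => ?_⟩
      · rw [h0]
        exact C_le hK hmem
      · rw [h0]
        exact groupPolynomials_le_C _
      · rw [h0]
        have := hlt n hn hfn
        exact hdown _ (groupPolynomials_le_C _) n (b - 1) hn (by omega) (mem_C (by omega) _)

/-- `exists_joinand` for a family of operations given by a family of functions. -/
theorem exists_joinand_of_lift (f : ∀ n, Op (ZMod 8) n) (F : ℕ → Fn) {k : ℕ} (hk : 1 ≤ k)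
    (hF : ∀ n, k ≤ n → lift (f n) = F n)
    (hd : ∀ L, Closed L → ∀ n, k ≤ n → F (n + 1) ∈ L → F n ∈ L) {K : Clone (ZMod 8)}
    (hK : groupPolynomials ≤ K) :
    ∃ N : ℕ∞, joinand f k N ≤ K ∧ groupPolynomials ≤ joinand f k N ∧
      ∀ (J : Clone (ZMod 8)) (hJ : groupPolynomials ≤ J), joinand f k N ≤ J →
        ∀ n, k ≤ n → F n ∈ infinitary K hK → F n ∈ infinitary J hJ := by
  obtain ⟨N, h1, h2, h3⟩ := exists_joinand f hk (fun K hK n hn h => by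
    rw [← lift_mem_infinitary_iff hK (by omega), hF n hn]
    rw [← lift_mem_infinitary_iff hK (by omega), hF (n + 1) (by omega)] at h
    exact hd _ (closed_infinitary hK) n hn h) hK
  refine ⟨N, h1, h2, fun J hJ hNJ n hn h => ?_⟩
  rw [← hF n hn, lift_mem_infinitary_iff _ (by omega)] at h ⊢
  exact hNJ n (h3 n hn h)

/-! ### Clones in the interval as joins -/

/-- The affine part of an operation lies in both clones, so its pure summands lie in `K`; these
transfer to `J` one by one. -/
theorem le_of_transfer {K J : Clone (ZMod 8)} (hK : groupPolynomials ≤ K)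
    (hJ : groupPolynomials ≤ J) (hKM : K ≤ M₁)
    (h : Transfer (infinitary K hK) (infinitary J hJ)) : K ≤ J := by
  intro n f hf
  obtain ⟨hn, hf'⟩ := mem_M₁_iff.1 (hKM n hf)
  obtain ⟨g, hg, c, α, β, hfg⟩ := hf'.decomposes
  have hcK := closed_infinitary hK
  have hcJ := closed_infinitary hJ
  have h1 := lift_mem_infinitary hK hf
  rw [hfg, AddSubgroup.add_mem_cancel_left _ (hg _ hcK)] at h1
  rw [← lift_mem_infinitary_iff hJ hn, hfg]
  exact AddSubgroup.add_mem _ (hg _ hcJ) (AddSubgroup.sum_mem _ fun A hA =>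
    hcK.transfer hcJ h (hcK.pureFn_mem_of_sum_mem c α β _ h1 A hA))

theorem exists_eq_join {K : Clone (ZMod 8)} (hK : groupPolynomials ≤ K) (hKM : K ≤ M₁) :
    ∃ n₁ n₂ n₃ n₄ n₅ n₆ n₇ n₈ : ℕ∞,
      K = joinand (fun n => 2 * t n) 1 n₁ ⊔ joinand (fun n => 2 * u n) 1 n₂ ⊔
          joinand (fun n => 2 * v n) 2 n₃ ⊔ joinand (fun n => 2 * s n) 1 n₄ ⊔
          joinand (fun n => 2 * p n) 1 n₅ ⊔ joinand (fun n => 2 * q n) 1 n₆ ⊔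
          joinand (fun n => 2 * r n) 1 n₇ ⊔ joinand (fun n => 4 * r n) 1 n₈ := by
  obtain ⟨n₁, a₁, -, c₁⟩ := exists_joinand_of_lift (fun n => 2 * t n) tFn le_rfl
    (fun n _ => lift_two_mul_t n) (fun L hL n hn h => hL.tFn_pred hn h) hK
  obtain ⟨n₂, a₂, -, c₂⟩ := exists_joinand_of_lift (fun n => 2 * u n) uFn le_rfl
    (fun n hn => lift_two_mul_u hn) (fun L hL n _ h => hL.range_pred h) hK
  obtain ⟨n₃, a₃, -, c₃⟩ := exists_joinand_of_lift (fun n => 2 * v n) vFn one_le_two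
    (fun n hn => lift_two_mul_v hn) (fun L hL n _ h => hL.range_pred h) hK
  obtain ⟨n₄, a₄, -, c₄⟩ := exists_joinand_of_lift (fun n => 2 * s n) sFn le_rfl
    (fun n _ => lift_two_mul_s n) (fun L hL n _ h => hL.sFn_pred h) hK
  obtain ⟨n₅, a₅, -, c₅⟩ := exists_joinand_of_lift (fun n => 2 * p n) pFn le_rfl
    (fun n hn => lift_two_mul_p hn) (fun L hL n _ h => hL.range_pred h) hK
  obtain ⟨n₆, a₆, -, c₆⟩ := exists_joinand_of_lift (fun n => 2 * q n) qFn le_rfl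
    (fun n hn => lift_two_mul_q hn) (fun L hL n _ h => hL.range_pred h) hK
  obtain ⟨n₇, a₇, -, c₇⟩ := exists_joinand_of_lift (fun n => 2 * r n) rFn le_rfl
    (fun n _ => lift_two_mul_r n) (fun L hL n _ h => hL.range_pred h) hK
  obtain ⟨n₈, a₈, b₈, c₈⟩ := exists_joinand_of_lift (fun n => 4 * r n) eFn le_rfl
    (fun n _ => lift_four_mul_r n) (fun L hL n _ h => hL.range_pred h) hK
  refine ⟨n₁, n₂, n₃, n₄, n₅, n₆, n₇, n₈, le_antisymm ?_ ?_⟩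
  · refine le_of_transfer hK (b₈.trans le_sup_right) hKM ⟨c₁ _ _ ?_, c₂ _ _ ?_, c₃ _ _ ?_,
      c₄ _ _ ?_, c₅ _ _ ?_, c₆ _ _ ?_, c₇ _ _ ?_, c₈ _ _ ?_⟩
    · exact le_sup_of_le_left (le_sup_of_le_left (le_sup_of_le_left (le_sup_of_le_left
        (le_sup_of_le_left (le_sup_of_le_left le_sup_left)))))
    · exact le_sup_of_le_left (le_sup_of_le_left (le_sup_of_le_left (le_sup_of_le_left
        (le_sup_of_le_left (le_sup_of_le_left le_sup_right)))))
    · exact le_sup_of_le_left (le_sup_of_le_left (le_sup_of_le_left (le_sup_of_le_left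
        (le_sup_of_le_left le_sup_right))))
    · exact le_sup_of_le_left (le_sup_of_le_left (le_sup_of_le_left (le_sup_of_le_left
        le_sup_right)))
    · exact le_sup_of_le_left (le_sup_of_le_left (le_sup_of_le_left le_sup_right))
    · exact le_sup_of_le_left (le_sup_of_le_left le_sup_right)
    · exact le_sup_of_le_left le_sup_right
    · exact le_sup_right
  · exact sup_le (sup_le (sup_le (sup_le (sup_le (sup_le (sup_le a₁ a₂) a₃) a₄) a₅) a₆) a₇) a₈

end CloneZ8

theorem theorem4p3 :
    (∀ (n : ℕ) (f : CloneZ8.Op (ZMod 8) n),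
      f ∈ CloneZ8.M₁.ops n ↔
        0 < n ∧ ∃ P : MvPolynomial (Fin n) (ZMod 8),
          (∀ α, 2 ≤ α.degree → Even (P.coeff α)) ∧ ∀ x, f x = MvPolynomial.eval x P) ∧
    ∀ K : CloneZ8.Clone (ZMod 8), CloneZ8.groupPolynomials ≤ K → K ≤ CloneZ8.M₁ →
      ∃ n₁ n₂ n₃ n₄ n₅ n₆ n₇ n₈ : ℕ∞,
        K = CloneZ8.joinand (fun n => 2 * CloneZ8.t n) 1 n₁ ⊔
            CloneZ8.joinand (fun n => 2 * CloneZ8.u n) 1 n₂ ⊔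
            CloneZ8.joinand (fun n => 2 * CloneZ8.v n) 2 n₃ ⊔
            CloneZ8.joinand (fun n => 2 * CloneZ8.s n) 1 n₄ ⊔
            CloneZ8.joinand (fun n => 2 * CloneZ8.p n) 1 n₅ ⊔
            CloneZ8.joinand (fun n => 2 * CloneZ8.q n) 1 n₆ ⊔
            CloneZ8.joinand (fun n => 2 * CloneZ8.r n) 1 n₇ ⊔
            CloneZ8.joinand (fun n => 4 * CloneZ8.r n) 1 n₈ :=
  ⟨fun _ _ => CloneZ8.mem_M₁_iff, fun _ hK hKM => CloneZ8.exists_eq_join hK hKM⟩
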